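/- For each $p\ge 1$ let $n=n_p\in\mathbb N$, $c=c_p>0$, $h=h_p\in(0,1)$, let $X=X_p\in\mathbb R^{n\times p}$ be a design matrix and $Y=Y_p\in\mathbb R^n$ a data vector. Fix $m\ge 2$ and suppose that, for every $p\ge m$, $Y\neq 0$, the first $m$ columns of $X$ are non-zero multiples of $Y$, and the other $p-m$ columns are orthogonal to the first $m$ ones. Let $f=f_p$ be the posterior on $\{0,1\}^p$ of the Bayesian variable selection model with $g$-prior of scale $c$, prior $p(\sigma^2)\propto 1/\sigma^2$ and independent $\mathrm{Bern}(h)$ inclusion variables, with the inverse in the $g$-prior replaced by a generalised inverse: $$f(\gamma)\propto h^{|\gamma|}(1-h)^{p-|\gamma|}(1+c)^{-|\gamma|/2}\Big(Y^TY-\tfrac{c}{1+c}\,Y^TX_\gamma (X_\gamma^TX_\gamma)^{-}X_\gamma^TY\Big)^{-n/2},$$ where $|\gamma|=\sum_i\gamma_i$, $X_\gamma$ is the matrix of the columns of $X$ with $\gamma_i=1$, and $A^-$ is the (Moore–Penrose) generalised inverse of $A$. Let $\gamma^{(i)}$ denote $\gamma$ with its $i$-th coordinate switched, and $f(\gamma_i|\gamma_{-i})$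 the full conditionals of $f$. * GS is the random-scan Gibbs sampler: choose $i$ uniformly in $\{1,\dots,p\}$, then resample $\gamma_i$ from $f(\cdot|\gamma_{-i})$. Its Metropolised version instead moves to $\gamma^{(i)}$ with probability $\min\{1,f(\gamma^{(i)})/f(\gamma)\}$ and stays put otherwise. The relaxation time $t_{GS}$ is the inverse of the spectral gap (one minus the second largest eigenvalue) of the transition matrix. * Given weight functions $\eta_i(\gamma_{-i})$, put $p_i(\gamma)=\eta_i(\gamma_{-i})/(2f(\gamma_i|\gamma_{-i}))$, $\zeta=\sum_i\mathbb E_f[\eta_i]$ and $Z(\gamma)=\zeta^{-1}\sum_ip_i(\gamma)$. The tempered Gibbs chain $P$ chooses $i$ with probability proportional to $p_i(\gamma)$ and moves to $\gamma^{(i)}$. Its relaxation time is the inverse of the smallest non-zero eigenvalue of $-Q$, where $Q(\gamma,\gamma')=Z(\gamma)P(\gamma,\gamma')$ for $\gamma'\ne\gamma$ and the rows of $Q$ sum to zero. TGS is the case $\eta_i=1$, with relaxation time $t_{TGS}$; wTGS is the case $\eta_i(\gamma_{-i})=f(\gamma_i=1|\gamma_{-i})+k/p$ for a fixed $k\ge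 0$, with relaxation time $t_{wTGS}$. Assume that, as $p\to\infty$ with $m$ and $k$ fixed, $\lim h(1+c)^{-1/2}=0$, $\limsup h<1$ and $\liminf h^2(1+c)^{(n-2)/2}>0$. Then there are constants $C_1,C_2,C_3>0$ such that for all sufficiently large $p$ $$t_{GS}\ \ge\ C_1\,c^{1/2}h^{-1}p,\qquad t_{TGS}\ \ge\ C_2\,p,\qquad t_{wTGS}\ \le\ C_3\,s,$$ where $s=\mathbb E_f[|\gamma|]$ is the posterior expected model size. The first bound holds both for GS and for its Metropolised version. -/

import Mathlib

open Filter Topology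

namespace BVS

section Samplers

variable {ι : Type*} [Fintype ι] [DecidableEq ι]

/-- The configuration `γ` with its `i`-th coordinate switched. -/
def switch (γ : ι → Bool) (i : ι) : ι → Bool := Function.update γ i (!γ i)

/-- The full conditional probability `f(γ_i = b | γ_{-i})`. -/
noncomputable def condProb (f : (ι → Bool) → ℝ) (i : ι) (b : Bool) (γ : ι → Bool) : ℝ :=
  f (Function.update γ i b) / ∑ b' : Bool, f (Function.update γ i b')

/-- The expectation of `g` under the probability mass function `f`. -/
def expect (f g : (ι → Bool) → ℝ) : ℝ := ∑ γ, f γ * g γ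

/-- The number `|γ|` of active coordinates. -/
def numActive (γ : ι → Bool) : ℕ := ∑ i, if γ i then 1 else 0

/-- The smallest non-zero (real) eigenvalue of a square matrix. -/
noncomputable def minNonzeroEigenvalue {S : Type*} [Fintype S] [DecidableEq S]
    (L : Matrix S S ℝ) : ℝ :=
  sInf {t : ℝ | t ≠ 0 ∧ Module.End.HasEigenvalue (Matrix.toLin' L) t}

/-- Spectral gap of a reversible irreducible Markov transition matrix `P`: one minus its second
largest eigenvalue, that is, the smallest non-zero eigenvalue of `1 - P`. -/
noncomputable def kernelGap {S : Type*} [Fintype S] [DecidableEq S] (P : Matrix S S ℝ) : ℝ :=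
  minNonzeroEigenvalue (1 - P)

/-- Spectral gap of a jump matrix `Q`: the smallest non-zero eigenvalue of `-Q`. -/
noncomputable def jumpGap {S : Type*} [Fintype S] [DecidableEq S] (Q : Matrix S S ℝ) : ℝ :=
  minNonzeroEigenvalue (-Q)

/-- Random-scan Gibbs sampler: pick a coordinate `i` uniformly at random, then draw the new value
of `γ_i` from its full conditional. -/
noncomputable def gibbsKernel (f : (ι → Bool) → ℝ) : Matrix (ι → Bool) (ι → Bool) ℝ :=
  Matrix.of fun γ γ' =>
    ∑ i, (1 / (Fintype.card ι : ℝ)) *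
      ∑ b : Bool, condProb f i b γ * if γ' = Function.update γ i b then 1 else 0

/-- Acceptance probability of the Metropolised Gibbs update of coordinate `i`, which proposes to
switch `γ_i`. -/
noncomputable def acceptProb (f : (ι → Bool) → ℝ) (i : ι) (γ : ι → Bool) : ℝ :=
  min 1 (condProb f i (!γ i) γ / condProb f i (γ i) γ)

/-- Metropolised random-scan Gibbs sampler: pick `i` uniformly at random, then switch `γ_i` with
probability `acceptProb f i γ` and stay otherwise. -/
noncomputable def metropolisedGibbsKernel (f : (ι → Bool) → ℝ) :
    Matrix (ι → Bool) (ι → Bool) ℝ :=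
  Matrix.of fun γ γ' =>
    ∑ i, (1 / (Fintype.card ι : ℝ)) *
      ((acceptProb f i γ * if γ' = switch γ i then 1 else 0)
        + (1 - acceptProb f i γ) * if γ' = γ then 1 else 0)

/-- The selection weights `p_i(γ) = η_i(γ) / (2 f(γ_i | γ_{-i}))` of weighted tempered Gibbs
sampling with uniform modified conditionals on `{0,1}`. -/
noncomputable def selWeight (f : (ι → Bool) → ℝ) (η : ι → (ι → Bool) → ℝ) (i : ι)
    (γ : ι → Bool) : ℝ :=
  η i γ * (1 / 2) / condProb f i (γ i) γ

/-- The normalising constant `ζ = ∑ i, E_f[η_i]`. -/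
noncomputable def zetaConst (f : (ι → Bool) → ℝ) (η : ι → (ι → Bool) → ℝ) : ℝ :=
  ∑ i, expect f (η i)

/-- `Z(γ) = ζ⁻¹ ∑ i, p_i(γ)`; the importance weight of `γ` is its inverse. -/
noncomputable def Zfun (f : (ι → Bool) → ℝ) (η : ι → (ι → Bool) → ℝ) (γ : ι → Bool) : ℝ :=
  (zetaConst f η)⁻¹ * ∑ i, selWeight f η i γ

/-- Transition matrix of (weighted) tempered Gibbs sampling: choose `i` with probability
proportional to `p_i(γ)`, then switch `γ_i`. -/
noncomputable def temperedKernel (f : (ι → Bool) → ℝ) (η : ι → (ι → Bool) → ℝ) :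
    Matrix (ι → Bool) (ι → Bool) ℝ :=
  Matrix.of fun γ γ' =>
    ∑ i, (selWeight f η i γ / ∑ j, selWeight f η j γ) * if γ' = switch γ i then 1 else 0

/-- Jump matrix of the continuous-time version: `Q(γ,γ') = Z(γ) P(γ,γ')` off the diagonal, and
rows summing to zero. -/
noncomputable def temperedJump (f : (ι → Bool) → ℝ) (η : ι → (ι → Bool) → ℝ) :
    Matrix (ι → Bool) (ι → Bool) ℝ :=
  Matrix.of fun γ γ' =>
    if γ' = γ then -∑ δ ∈ Finset.univ.erase γ, Zfun f η γ * temperedKernel f η γ δ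
    else Zfun f η γ * temperedKernel f η γ γ'

/-- Weight functions of TGS. -/
def etaTGS : ι → (ι → Bool) → ℝ := fun _ _ => 1

/-- Weight functions `η_i(γ_{-i}) = f(γ_i = 1 | γ_{-i}) + k / p` of wTGS. -/
noncomputable def etaWTGS (f : (ι → Bool) → ℝ) (k : ℝ) : ι → (ι → Bool) → ℝ :=
  fun i γ => condProb f i true γ + k / (Fintype.card ι : ℝ)

/-- Relaxation time of the (plain) random-scan Gibbs sampler. -/
noncomputable def relaxGS (f : (ι → Bool) → ℝ) : ℝ := (kernelGap (gibbsKernel f))⁻¹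

/-- Relaxation time of the Metropolised random-scan Gibbs sampler. -/
noncomputable def relaxMetropolisedGS (f : (ι → Bool) → ℝ) : ℝ :=
  (kernelGap (metropolisedGibbsKernel f))⁻¹

/-- Relaxation time of TGS. -/
noncomputable def relaxTGS (f : (ι → Bool) → ℝ) : ℝ := (jumpGap (temperedJump f etaTGS))⁻¹

/-- Relaxation time of wTGS with parameter `k`. -/
noncomputable def relaxWTGS (f : (ι → Bool) → ℝ) (k : ℝ) : ℝ :=
  (jumpGap (temperedJump f (etaWTGS f k)))⁻¹

/-- The expected number of active coordinates `E_f[|γ|]`. -/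
noncomputable def expectedSize (f : (ι → Bool) → ℝ) : ℝ := expect f fun γ => (numActive γ : ℝ)

end Samplers

section Posterior

open Matrix

variable {N ι : Type*} [Fintype N] [Fintype ι] [DecidableEq ι]

/-- The submatrix `X_γ` of the columns of `X` included in the model `γ`. -/
def activeCols (X : Matrix N ι ℝ) (γ : ι → Bool) : Matrix N {i // γ i = true} ℝ :=
  X.submatrix id Subtype.val

/-- The Moore-Penrose generalised inverse of a symmetric real matrix: invert the non-zero
eigenvalues in the spectral decomposition and leave the zero ones equal to zero. -/
noncomputable def symmPinv {κ : Type*} [Fintype κ] [DecidableEq κ] (A : Matrix κ κ ℝ) :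
    Matrix κ κ ℝ :=
  cfc (fun x : ℝ => x⁻¹) A

theorem symmPinv_generalised_inverse {κ : Type*} [Fintype κ] [DecidableEq κ]
    (A : Matrix κ κ ℝ) (hA : A.IsHermitian) :
    A * symmPinv A * A = A ∧ symmPinv A * A * symmPinv A = symmPinv A ∧
      (symmPinv A).IsHermitian ∧ A * symmPinv A = symmPinv A * A := by
  have hs : IsSelfAdjoint A := hA
  have hf : ContinuousOn (fun x : ℝ => x⁻¹) (spectrum ℝ A) :=
    (Matrix.finite_real_spectrum (A := A)).continuousOn _
  have hi : ContinuousOn (fun x : ℝ => x) (spectrum ℝ A) := continuousOn_id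
  have h1 : A = cfc (fun x : ℝ => x) A := (cfc_id' ℝ A).symm
  have e1 : A * symmPinv A = cfc (fun x : ℝ => x * x⁻¹) A := by
    rw [cfc_mul (fun x : ℝ => x) (fun x : ℝ => x⁻¹) A hi hf, ← h1, symmPinv]
  have e2 : symmPinv A * A = cfc (fun x : ℝ => x⁻¹ * x) A := by
    rw [cfc_mul (fun x : ℝ => x⁻¹) (fun x : ℝ => x) A hf hi, ← h1, symmPinv]
  refine ⟨?_, ?_, ?_, ?_⟩
  · rw [e1]
    nth_rewrite 2 [h1]
    rw [← cfc_mul (fun x : ℝ => x * x⁻¹) (fun x : ℝ => x) A (hi.mul hf) hi]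
    conv_rhs => rw [h1]
    congr 1
    funext x
    exact mul_inv_mul_cancel x
  · rw [e2, symmPinv, ← cfc_mul (fun x : ℝ => x⁻¹ * x) (fun x : ℝ => x⁻¹) A (hf.mul hi) hf]
    congr 1
    funext x
    by_cases hx : x = 0 <;> simp [hx]
  · exact cfc_predicate (p := IsSelfAdjoint) (fun x : ℝ => x⁻¹) A
  · rw [e1, e2]
    congr 1
    funext x
    exact mul_comm _ _

/-- `S(γ) = Yᵀ Y - c / (1 + c) * Yᵀ X_γ (X_γᵀ X_γ)⁻ X_γᵀ Y`. -/
noncomputable def residual (X : Matrix N ι ℝ) (Y : N → ℝ) (c : ℝ) (γ : ι → Bool) : ℝ :=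
  Y ⬝ᵥ Y - c / (1 + c) *
    (((activeCols X γ)ᵀ *ᵥ Y) ⬝ᵥ
      (symmPinv ((activeCols X γ)ᵀ * activeCols X γ) *ᵥ ((activeCols X γ)ᵀ *ᵥ Y)))

/-- The marginal likelihood `p(Y | γ)`, up to a factor independent of `γ`, under
`Y | β, γ, σ² ~ N(X_γ β, σ² I)`, the g-prior with scale `c` and `p(σ²) ∝ 1 / σ²`. Where
`X_γᵀ X_γ` is singular the inverse in the g-prior formula is replaced by a generalised inverse. -/
noncomputable def margLik (X : Matrix N ι ℝ) (Y : N → ℝ) (c : ℝ) (γ : ι → Bool) : ℝ :=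
  (1 + c) ^ (-((numActive γ : ℝ) / 2)) *
    residual X Y c γ ^ (-((Fintype.card N : ℝ) / 2))

/-- The independent Bernoulli(`h`) prior on the inclusion variables. -/
noncomputable def prior (h : ℝ) (γ : ι → Bool) : ℝ := ∏ i, if γ i then h else 1 - h

/-- The posterior probability mass function `p(γ | Y)`. -/
noncomputable def posterior (X : Matrix N ι ℝ) (Y : N → ℝ) (c h : ℝ) (γ : ι → Bool) : ℝ :=
  prior h γ * margLik X Y c γ / ∑ γ' : ι → Bool, prior h γ' * margLik X Y c γ'

end Posterior

/-- The first `m` regressors are non-zero multiples of the non-zero data vector `Y` and the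
remaining ones are orthogonal to the first `m`. -/
structure CollinearDesign {n p : ℕ} (m : ℕ) (X : Matrix (Fin n) (Fin p) ℝ)
    (Y : Fin n → ℝ) : Prop where
  data_ne_zero : Y ≠ 0
  collinear : ∀ i : Fin p, i.val < m → ∃ a : ℝ, a ≠ 0 ∧ X.col i = a • Y
  orthogonal : ∀ i j : Fin p, i.val < m → m ≤ j.val → X.col i ⬝ᵥ X.col j = 0

end BVS

/-!
Write `S` for the block of the first `m` coordinates. Every model containing a coordinate of `S`
fits `Y` perfectly, and every other model is orthogonal to `Y`, so the residual takes only the two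
values `YᵀY / (1 + c)` and `YᵀY`. Hence the posterior is proportional to `a ^ |γ|`, times
`B = (1 + c) ^ (n / 2)` if `S` is active, where `a = h (1 + c)^{-1/2} / (1 - h)`
(`CollinearDesign.isCollinearPMF`). In the asymptotic regime `a → 0` while `a² B` stays bounded
away from zero (`eventually_regime`).

All four samplers are reversible with respect to the posterior and switch one coordinate at a
time; their spectral gaps are those of generators `g ↦ ∑ i, r i γ * (g γ - g (switch γ i))`. By
the spectral theorem such a gap is bounded above by the Dirichlet form over the variance of any
test function (`gap_pos_and_gap_mul_variance_le`), and below by any Poincaré inequality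
(`inv_minNonzeroEigenvalue_le`).

*Lower bounds.* The event that one given coordinate of `S` is the only active one in `S` has
probability at most `1 / 2` by symmetry. Leaving it means switching a coordinate of `S`, to a
configuration whose mass is smaller by a factor `O(a)`: adding a coordinate costs `a`,
removing the only one costs `1 / (a B) = a / (a² B)`. The Gibbs samplers therefore leave at rate `O(a / p)`,
tempered Gibbs sampling at rate `O(1 / p)` (`IsCollinearPMF.le_inv_gap`).

*Upper bound.* Weighted tempered Gibbs sampling crosses each edge with a flow at least the mass of
its larger model divided by `2 (s + k)`. For the energy with these edge masses the posterior
satisfies a Poincaré inequality with a constant depending on `m` only (`IsCollinearPMF.poincare`):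
averaging removes the independent coordinates outside `S` one by one, and inside `S` every
configuration is joined to the inactive one by deactivating coordinates, along which the mass does
not decrease until the last step, whose edge is still charged with the mass of its larger model.
Since `s ≥ 1 / 2`, the constant `k` is absorbed into `s`.
-/

namespace BVS

/-! ### Spectra of reversible generators -/

section Spectral

variable {S : Type*} [Fintype S]

theorem sum_mul_mulVec_comm {L : Matrix S S ℝ} {w : S → ℝ}
    (hsymm : ∀ x y, w x * L x y = w y * L y x) (u g : S → ℝ) :
    ∑ x, w x * ((L.mulVec u) x * g x) = ∑ x, w x * (u x * (L.mulVec g) x) := by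
  simp only [Matrix.mulVec, dotProduct, Finset.sum_mul, Finset.mul_sum]
  rw [Finset.sum_comm]
  refine Finset.sum_congr rfl fun x _ => Finset.sum_congr rfl fun y _ => ?_
  linear_combination u x * g y * hsymm y x

variable [DecidableEq S]

/-- A matrix which is self-adjoint for the inner product with weights `w`, and whose kernel consists
of constants, has a non-zero eigenvalue bounded by the Rayleigh quotient of any non-zero vector
orthogonal to the constants. The proof diagonalises the symmetric matrix
`√(w x) * L x y / √(w y)`. -/
theorem exists_eigenvalue_le_rayleigh {L : Matrix S S ℝ} {w : S → ℝ} (hw : ∀ x, 0 < w x)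
    (hsymm : ∀ x y, w x * L x y = w y * L y x)
    (hker : ∀ g : S → ℝ, L.mulVec g = 0 → ∀ x y, g x = g y)
    (g : S → ℝ) (hg : ∑ x, w x * g x = 0) (hg0 : g ≠ 0) :
    ∃ t : ℝ, t ≠ 0 ∧ Module.End.HasEigenvalue (Matrix.toLin' L) t ∧
      t * ∑ x, w x * g x ^ 2 ≤ ∑ x, w x * (g x * (L.mulVec g) x) := by
  have hq : ∀ x, √(w x) ≠ 0 := fun x => (Real.sqrt_pos.2 (hw x)).ne'
  have hqq : ∀ x, √(w x) * √(w x) = w x := fun x => Real.mul_self_sqrt (hw x).le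
  set M : Matrix S S ℝ := Matrix.of fun x y => √(w x) * L x y * (√(w y))⁻¹ with hMdef
  have hM : M.IsHermitian := by
    ext x y
    have h1 := hsymm x y
    rw [← hqq x, ← hqq y] at h1
    simp only [hMdef, Matrix.conjTranspose_apply, Matrix.of_apply, star_trivial]
    field_simp [hq x, hq y]
    linear_combination -h1
  set b := hM.eigenvectorBasis
  set u : S → S → ℝ := fun j x => (√(w x))⁻¹ * (b j).ofLp x with hu
  have hub : ∀ j x, (b j).ofLp x = √(w x) * u j x := fun j x => by
    simp only [hu]; rw [mul_inv_cancel_left₀ (hq x)]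
  have hLu : ∀ j, L.mulVec (u j) = hM.eigenvalues j • u j := by
    intro j
    ext x
    have h1 := congrFun (hM.mulVec_eigenvectorBasis j) x
    have h2 : (M.mulVec (b j).ofLp) x = √(w x) * (L.mulVec (u j)) x := by
      simp only [Matrix.mulVec, dotProduct, Finset.mul_sum, hMdef, Matrix.of_apply, hu]
      exact Finset.sum_congr rfl fun y _ => by ring
    have h3 : √(w x) * (L.mulVec (u j)) x = hM.eigenvalues j * (b j).ofLp x := by
      rw [← h2]; simpa using h1
    rw [hub] at h3
    have h4 : √(w x) * (L.mulVec (u j) x) = √(w x) * (hM.eigenvalues j * u j x) := by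
      rw [h3]; ring
    simpa using mul_left_cancel₀ (hq x) h4
  have hu0 : ∀ j, u j ≠ 0 := by
    intro j h0
    have : b j = 0 := by
      ext x
      rw [hub, h0]; simp
    have h1 : ‖b j‖ = 1 := b.orthonormal.1 j
    simp [this] at h1
  have heig : ∀ j, Module.End.HasEigenvalue (Matrix.toLin' L) (hM.eigenvalues j) := by
    intro j
    refine Module.End.hasEigenvalue_of_hasEigenvector (x := u j) ⟨?_, hu0 j⟩
    rw [Module.End.mem_eigenspace_iff, Matrix.toLin'_apply]
    exact hLu j
  -- coordinates of `√w * k` in the eigenbasis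
  have hin : ∀ (j : S) (k : S → ℝ),
      inner ℝ (b j) (WithLp.toLp 2 fun x => √(w x) * k x) = ∑ x, w x * (u j x * k x) := by
    intro j k
    rw [EuclideanSpace.inner_eq_star_dotProduct]
    simp only [dotProduct, star_trivial]
    refine Finset.sum_congr rfl fun x _ => ?_
    rw [hub]; linear_combination k x * u j x * hqq x
  set c : S → ℝ := fun j => ∑ x, w x * (u j x * g x) with hcdef
  have hin2 : ∀ k l : S → ℝ, inner ℝ (WithLp.toLp 2 fun x => √(w x) * k x : EuclideanSpace ℝ S)
      (WithLp.toLp 2 fun x => √(w x) * l x) = ∑ x, w x * (k x * l x) := by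
    intro k l
    rw [EuclideanSpace.inner_eq_star_dotProduct]
    simp only [dotProduct, star_trivial]
    refine Finset.sum_congr rfl fun x _ => ?_
    linear_combination l x * k x * hqq x
  have hsum : ∀ l : S → ℝ, ∑ j, c j * (∑ x, w x * (u j x * l x)) = ∑ x, w x * (g x * l x) := by
    intro l
    rw [← hin2 g l, ← b.sum_inner_mul_inner]
    refine Finset.sum_congr rfl fun j _ => ?_
    rw [hin, real_inner_comm, hin]
  have hnorm : ∑ j, c j ^ 2 = ∑ x, w x * g x ^ 2 := by
    simp only [sq]
    exact hsum g
  have hray : ∑ j, hM.eigenvalues j * c j ^ 2 = ∑ x, w x * (g x * (L.mulVec g) x) := by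
    rw [← hsum]
    refine Finset.sum_congr rfl fun j _ => ?_
    rw [← sum_mul_mulVec_comm hsymm, hLu j]
    simp only [hcdef, Pi.smul_apply, smul_eq_mul, sq, Finset.mul_sum, Finset.sum_mul]
    refine Finset.sum_congr rfl fun x _ => ?_
    refine Finset.sum_congr rfl fun y _ => ?_
    ring
  have hzero : ∀ j, hM.eigenvalues j = 0 → c j = 0 := by
    intro j hj
    have hconst := hker (u j) (by rw [hLu j, hj, zero_smul])
    calc c j = ∑ x, w x * (u j j * g x) :=
          Finset.sum_congr rfl fun x _ => by rw [hconst x j]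
      _ = u j j * ∑ x, w x * g x := by
          rw [Finset.mul_sum]; exact Finset.sum_congr rfl fun x _ => by ring
      _ = 0 := by rw [hg, mul_zero]
  have hpos : 0 < ∑ x, w x * g x ^ 2 := by
    obtain ⟨x, hx⟩ := Function.ne_iff.1 hg0
    refine Finset.sum_pos' (fun y _ => mul_nonneg (hw y).le (sq_nonneg _))
      ⟨x, Finset.mem_univ x, ?_⟩
    have : g x ≠ 0 := hx
    have := hw x
    positivity
  by_contra! hcon
  -- otherwise every non-zero eigenvalue exceeds the average `∑ λ_j c_j² / ∑ c_j²`
  have hlt : ∀ j, c j ≠ 0 →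
      ∑ x, w x * (g x * (L.mulVec g) x) < hM.eigenvalues j * ∑ x, w x * g x ^ 2 :=
    fun j hj => hcon _ (fun h0 => hj (hzero j h0)) (heig j)
  obtain ⟨j, hj⟩ : ∃ j, c j ≠ 0 := by
    by_contra! h0
    rw [← hnorm] at hpos
    simp [h0] at hpos
  have hfin : ∑ j, c j ^ 2 * (∑ x, w x * (g x * (L.mulVec g) x)) <
      ∑ j, c j ^ 2 * (hM.eigenvalues j * ∑ x, w x * g x ^ 2) := by
    refine Finset.sum_lt_sum (fun i _ => ?_) ⟨j, Finset.mem_univ j, ?_⟩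
    · by_cases hi : c i = 0
      · simp [hi]
      · exact mul_le_mul_of_nonneg_left (hlt i hi).le (sq_nonneg _)
    · exact mul_lt_mul_of_pos_left (hlt j hj) (by positivity)
  rw [← Finset.sum_mul, hnorm, ← hray] at hfin
  have : ∑ j, c j ^ 2 * (hM.eigenvalues j * ∑ x, w x * g x ^ 2) =
      (∑ x, w x * g x ^ 2) * ∑ j, hM.eigenvalues j * c j ^ 2 := by
    rw [Finset.mul_sum]
    exact Finset.sum_congr rfl fun i _ => by ring
  linarith

theorem finite_nonzero_eigenvalues (L : Matrix S S ℝ) :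
    {t : ℝ | t ≠ 0 ∧ Module.End.HasEigenvalue (Matrix.toLin' L) t}.Finite :=
  (Module.End.finite_hasEigenvalue (Matrix.toLin' L)).subset fun _ ht => ht.2

theorem minNonzeroEigenvalue_le {L : Matrix S S ℝ} {t : ℝ} (h0 : t ≠ 0)
    (ht : Module.End.HasEigenvalue (Matrix.toLin' L) t) : minNonzeroEigenvalue L ≤ t :=
  csInf_le (finite_nonzero_eigenvalues L).bddBelow ⟨h0, ht⟩

theorem minNonzeroEigenvalue_mem {L : Matrix S S ℝ} {t : ℝ} (h0 : t ≠ 0)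
    (ht : Module.End.HasEigenvalue (Matrix.toLin' L) t) :
    minNonzeroEigenvalue L ≠ 0 ∧
      Module.End.HasEigenvalue (Matrix.toLin' L) (minNonzeroEigenvalue L) :=
  Set.Nonempty.csInf_mem (s := {t : ℝ | t ≠ 0 ∧ Module.End.HasEigenvalue (Matrix.toLin' L) t})
    ⟨t, h0, ht⟩ (finite_nonzero_eigenvalues L)

/-- An eigenvector for a non-zero eigenvalue of a weighted self-adjoint matrix annihilating the
constants is orthogonal to the constants. -/
theorem exists_centered_eigenvector {L : Matrix S S ℝ} {w : S → ℝ}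
    (hsymm : ∀ x y, w x * L x y = w y * L y x) (hone : L.mulVec (fun _ => 1) = 0)
    {t : ℝ} (h0 : t ≠ 0) (ht : Module.End.HasEigenvalue (Matrix.toLin' L) t) :
    ∃ v : S → ℝ, v ≠ 0 ∧ L.mulVec v = t • v ∧ ∑ x, w x * v x = 0 := by
  obtain ⟨v, hv⟩ := ht.exists_hasEigenvector
  have hv1 : L.mulVec v = t • v := by
    have := hv.apply_eq_smul
    rwa [Matrix.toLin'_apply] at this
  refine ⟨v, hv.2, hv1, ?_⟩
  have h1 := sum_mul_mulVec_comm hsymm v (fun _ => 1)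
  rw [hone, hv1] at h1
  simp only [Pi.smul_apply, smul_eq_mul, mul_one, Pi.zero_apply, mul_zero,
    Finset.sum_const_zero] at h1
  have h2 : t * ∑ x, w x * v x = 0 := by
    rw [← h1, Finset.mul_sum]
    exact Finset.sum_congr rfl fun x _ => by ring
  exact (mul_eq_zero.1 h2).resolve_left h0

end Spectral

/-! ### Generators of single-coordinate switching dynamics -/

section Switching

variable {ι : Type*} [DecidableEq ι]

theorem switch_apply_self (γ : ι → Bool) (i : ι) : switch γ i i = !γ i := by
  simp [switch]

theorem switch_apply_of_ne (γ : ι → Bool) {i j : ι} (h : j ≠ i) : switch γ i j = γ j := by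
  simp [switch, h]

theorem switch_switch (γ : ι → Bool) (i : ι) : switch (switch γ i) i = γ := by
  simp [switch]

theorem switch_ne (γ : ι → Bool) (i : ι) : switch γ i ≠ γ := by
  intro h
  have := congrFun h i
  simp [switch] at this

theorem update_switch (γ : ι → Bool) (i : ι) (b : Bool) :
    Function.update (switch γ i) i b = Function.update γ i b := by
  simp [switch]

theorem add_update_eq_add_switch (F : (ι → Bool) → ℝ) (i : ι) (γ : ι → Bool) :
    F (Function.update γ i true) + F (Function.update γ i false) = F γ + F (switch γ i) := by
  cases hb : γ i
  · have h1 : Function.update γ i false = γ := by rw [← hb, Function.update_eq_self]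
    rw [h1, switch, hb, add_comm]; rfl
  · have h1 : Function.update γ i true = γ := by rw [← hb, Function.update_eq_self]
    rw [h1, switch, hb]; rfl

variable [Fintype ι]

theorem sum_switch (i : ι) (F : (ι → Bool) → ℝ) : ∑ γ, F (switch γ i) = ∑ γ, F γ :=
  Equiv.sum_comp (Function.Involutive.toPerm (fun γ => switch γ i) fun γ => switch_switch γ i) F

/-- Grouping configurations into pairs which differ at `i` only; every pair is met twice. -/
theorem sum_eq_half_sum_update (i : ι) (F : (ι → Bool) → ℝ) :
    ∑ γ, F γ =
      (1 / 2) * ∑ γ, (F (Function.update γ i true) + F (Function.update γ i false)) := by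
  simp only [add_update_eq_add_switch, Finset.sum_add_distrib, sum_switch]
  ring

/-- The generator `g ↦ (γ ↦ ∑ i, r i γ * (g γ - g (switch γ i)))`, that is, minus the jump matrix of
the dynamics which switches `γ_i` at rate `r i γ`. -/
def flipGen (r : ι → (ι → Bool) → ℝ) : Matrix (ι → Bool) (ι → Bool) ℝ :=
  Matrix.of fun γ γ' => ∑ i, r i γ * ((if γ' = γ then 1 else 0) - if γ' = switch γ i then 1 else 0)

theorem flipGen_mulVec (r : ι → (ι → Bool) → ℝ) (g : (ι → Bool) → ℝ) (γ : ι → Bool) :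
    (flipGen r).mulVec g γ = ∑ i, r i γ * (g γ - g (switch γ i)) := by
  simp only [Matrix.mulVec, dotProduct, flipGen, Matrix.of_apply, Finset.sum_mul]
  rw [Finset.sum_comm]
  refine Finset.sum_congr rfl fun i _ => ?_
  simp only [mul_assoc, ← Finset.mul_sum, sub_mul, ite_mul, one_mul, zero_mul,
    Finset.sum_sub_distrib, Finset.sum_ite_eq', Finset.mem_univ, if_true]

variable {f : (ι → Bool) → ℝ} {r : ι → (ι → Bool) → ℝ}

theorem flipGen_symm (hrev : ∀ i γ, f γ * r i γ = f (switch γ i) * r i (switch γ i))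
    (γ γ' : ι → Bool) : f γ * flipGen r γ γ' = f γ' * flipGen r γ' γ := by
  simp only [flipGen, Matrix.of_apply, Finset.mul_sum]
  refine Finset.sum_congr rfl fun i _ => ?_
  by_cases h1 : γ' = γ
  · subst h1; rfl
  · by_cases h2 : γ' = switch γ i
    · subst h2
      have h3 : γ ≠ switch γ i := (switch_ne γ i).symm
      simp only [switch_ne, if_false, if_true, switch_switch, h3]
      linear_combination -hrev i γ
    · have h3 : γ ≠ γ' := fun h => h1 h.symm
      have h4 : γ ≠ switch γ' i := fun h => h2 (by rw [h, switch_switch])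
      simp [h1, h2, h3, h4]

/-- The Dirichlet form of the generator `flipGen r`. -/
theorem sum_mul_flipGen (hrev : ∀ i γ, f γ * r i γ = f (switch γ i) * r i (switch γ i))
    (g : (ι → Bool) → ℝ) :
    ∑ γ, f γ * (g γ * (flipGen r).mulVec g γ) =
      (1 / 2) * ∑ i, ∑ γ, f γ * r i γ * (g γ - g (switch γ i)) ^ 2 := by
  have h1 : ∀ i, ∑ γ, f γ * r i γ * (g γ - g (switch γ i)) ^ 2 =
      2 * ∑ γ, f γ * r i γ * (g γ * (g γ - g (switch γ i))) := by
    intro i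
    have h2 := sum_switch i fun γ => f γ * r i γ * (g γ * (g γ - g (switch γ i)))
    rw [two_mul]
    nth_rewrite 2 [← h2]
    rw [← Finset.sum_add_distrib]
    refine Finset.sum_congr rfl fun γ _ => ?_
    rw [← hrev, switch_switch]
    ring
  simp only [h1, ← Finset.mul_sum]
  rw [Finset.sum_comm]
  simp only [flipGen_mulVec, Finset.mul_sum]
  refine Finset.sum_congr rfl fun γ _ => Finset.sum_congr rfl fun i _ => ?_
  ring

theorem eq_of_forall_switch {g : (ι → Bool) → ℝ} (hg : ∀ i γ, g (switch γ i) = g γ)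
    (γ γ' : ι → Bool) : g γ = g γ' := by
  have key : ∀ T : Finset ι, g (fun i => if i ∈ T then γ' i else γ i) = g γ := by
    intro T
    induction T using Finset.induction_on with
    | empty => simp
    | insert j T hj ih =>
      rw [← ih]
      by_cases h : γ' j = γ j
      · congr 1
        ext i
        by_cases hij : i = j
        · subst hij; simp [hj, h]
        · simp [hij]
      · rw [← hg j]
        congr 1
        ext i
        by_cases hij : i = j
        · subst hij
          rw [switch_apply_self]
          simp only [Finset.mem_insert_self, if_true, hj, if_false]
          cases h1 : γ' i <;> cases h2 : γ i <;> simp_all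
        · rw [switch_apply_of_ne _ hij]
          simp [hij]
  have := key Finset.univ
  simpa using this.symm

theorem flipGen_kernel (hf : ∀ γ, 0 < f γ) (hr : ∀ i γ, 0 < r i γ)
    (hrev : ∀ i γ, f γ * r i γ = f (switch γ i) * r i (switch γ i))
    (g : (ι → Bool) → ℝ) (hg : (flipGen r).mulVec g = 0) (γ γ' : ι → Bool) : g γ = g γ' := by
  have h1 := sum_mul_flipGen hrev g
  have hnn : ∀ i γ, 0 ≤ f γ * r i γ * (g γ - g (switch γ i)) ^ 2 := fun i γ =>
    mul_nonneg (mul_pos (hf γ) (hr i γ)).le (sq_nonneg _)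
  rw [hg] at h1
  simp only [Pi.zero_apply, mul_zero, Finset.sum_const_zero] at h1
  have h2 : ∑ i, ∑ γ, f γ * r i γ * (g γ - g (switch γ i)) ^ 2 = 0 := by linarith
  refine eq_of_forall_switch (fun i γ => ?_) γ γ'
  have h3 := (Finset.sum_eq_zero_iff_of_nonneg
    fun i _ => Finset.sum_nonneg fun γ _ => hnn i γ).1 h2 i (Finset.mem_univ i)
  have h4 := (Finset.sum_eq_zero_iff_of_nonneg fun γ _ => hnn i γ).1 h3 γ (Finset.mem_univ γ)
  have h5 := (mul_eq_zero.1 h4).resolve_left (mul_pos (hf γ) (hr i γ)).ne'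
  have h6 := pow_eq_zero_iff (two_ne_zero) |>.1 h5
  linarith

theorem flipGen_mulVec_one : (flipGen r).mulVec (fun _ => 1) = 0 := by
  ext γ
  simp [flipGen_mulVec]

/-- A non-zero eigenvalue of `flipGen r` is the Rayleigh quotient of a centred eigenvector. -/
theorem exists_eigenvalue_eq_rayleigh
    (hrev : ∀ i γ, f γ * r i γ = f (switch γ i) * r i (switch γ i)) {t : ℝ} (h0 : t ≠ 0)
    (ht : Module.End.HasEigenvalue (Matrix.toLin' (flipGen r)) t) :
    ∃ v : (ι → Bool) → ℝ, v ≠ 0 ∧ ∑ γ, f γ * v γ = 0 ∧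
      t * ∑ γ, f γ * v γ ^ 2 = (1 / 2) * ∑ i, ∑ γ, f γ * r i γ * (v γ - v (switch γ i)) ^ 2 := by
  obtain ⟨v, hv0, hv1, hv2⟩ :=
    exists_centered_eigenvector (flipGen_symm hrev) flipGen_mulVec_one h0 ht
  refine ⟨v, hv0, hv2, ?_⟩
  rw [← sum_mul_flipGen hrev, hv1, Finset.mul_sum]
  exact Finset.sum_congr rfl fun γ _ => by simp only [Pi.smul_apply, smul_eq_mul]; ring

theorem sum_mul_sq_pos (hf : ∀ γ, 0 < f γ) {v : (ι → Bool) → ℝ} (hv : v ≠ 0) :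
    0 < ∑ γ, f γ * v γ ^ 2 := by
  obtain ⟨x, hx⟩ := Function.ne_iff.1 hv
  have hx' : v x ≠ 0 := hx
  refine Finset.sum_pos' (fun y _ => mul_nonneg (hf y).le (sq_nonneg _)) ⟨x, Finset.mem_univ x, ?_⟩
  have := hf x
  positivity

/-- A Poincaré inequality with constant `C` bounds the relaxation time by `C`. -/
theorem inv_minNonzeroEigenvalue_le (hf : ∀ γ, 0 < f γ)
    (hrev : ∀ i γ, f γ * r i γ = f (switch γ i) * r i (switch γ i)) {C : ℝ} (hC : 0 < C)
    (hP : ∀ g : (ι → Bool) → ℝ, ∑ γ, f γ * g γ = 0 →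
      ∑ γ, f γ * g γ ^ 2 ≤ C * ((1 / 2) * ∑ i, ∑ γ, f γ * r i γ * (g γ - g (switch γ i)) ^ 2)) :
    (minNonzeroEigenvalue (flipGen r))⁻¹ ≤ C := by
  by_cases hne : ∃ t : ℝ, t ≠ 0 ∧ Module.End.HasEigenvalue (Matrix.toLin' (flipGen r)) t
  · obtain ⟨t, h0, ht⟩ := hne
    obtain ⟨h0', ht'⟩ := minNonzeroEigenvalue_mem h0 ht
    obtain ⟨v, hv0, hv1, hv2⟩ := exists_eigenvalue_eq_rayleigh hrev h0' ht'
    have h1 := hP v hv1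
    rw [← hv2] at h1
    have h2 := sum_mul_sq_pos hf hv0
    have h3 : 1 ≤ C * minNonzeroEigenvalue (flipGen r) := by
      by_contra! hlt
      nlinarith
    have h4 : 0 < minNonzeroEigenvalue (flipGen r) := by
      by_contra! hle
      nlinarith
    rw [inv_le_iff_one_le_mul₀ h4]
    linarith
  · -- without non-zero eigenvalues the gap is `sInf ∅ = 0`, whose inverse is `0`
    have : {t : ℝ | t ≠ 0 ∧ Module.End.HasEigenvalue (Matrix.toLin' (flipGen r)) t} = ∅ := by
      ext t
      simp only [Set.mem_ofPred_eq, Set.mem_empty_iff_false, iff_false]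
      exact fun ht => hne ⟨t, ht⟩
    rw [minNonzeroEigenvalue, this, Real.sInf_empty, inv_zero]
    exact hC.le

/-- The spectral gap of an irreducible reversible generator is positive and at most the Dirichlet
form of `g` divided by the variance of `g`, for every non-constant test function `g`. -/
theorem gap_pos_and_gap_mul_variance_le (hf : ∀ γ, 0 < f γ) (hf1 : ∑ γ, f γ = 1)
    (hr : ∀ i γ, 0 < r i γ)
    (hrev : ∀ i γ, f γ * r i γ = f (switch γ i) * r i (switch γ i))
    (g : (ι → Bool) → ℝ) (hvar : 0 < ∑ γ, f γ * g γ ^ 2 - (∑ γ, f γ * g γ) ^ 2) :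
    0 < minNonzeroEigenvalue (flipGen r) ∧
      minNonzeroEigenvalue (flipGen r) * (∑ γ, f γ * g γ ^ 2 - (∑ γ, f γ * g γ) ^ 2) ≤
        (1 / 2) * ∑ i, ∑ γ, f γ * r i γ * (g γ - g (switch γ i)) ^ 2 := by
  set e := ∑ γ, f γ * g γ with he
  have hcent : ∑ γ, f γ * (g γ - e) = 0 := by
    simp only [mul_sub, Finset.sum_sub_distrib, ← Finset.sum_mul, hf1]
    rw [← he]; ring
  have hsq : ∑ γ, f γ * (g γ - e) ^ 2 = ∑ γ, f γ * g γ ^ 2 - e ^ 2 := by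
    have : ∀ γ, f γ * (g γ - e) ^ 2 = f γ * g γ ^ 2 - 2 * e * (f γ * g γ) + f γ * e ^ 2 :=
      fun γ => by ring
    simp only [this, Finset.sum_add_distrib, Finset.sum_sub_distrib, ← Finset.sum_mul,
      ← Finset.mul_sum, hf1, ← he]
    ring
  have hne : (fun γ => g γ - e) ≠ 0 := by
    intro h
    have h' : ∀ γ, g γ - e = 0 := fun γ => congrFun h γ
    simp only [h'] at hsq
    simp only [ne_eq, OfNat.ofNat_ne_zero, not_false_eq_true, zero_pow, mul_zero,
      Finset.sum_const_zero] at hsq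
    linarith
  obtain ⟨t, h0, ht, hle⟩ := exists_eigenvalue_le_rayleigh hf (flipGen_symm hrev)
    (flipGen_kernel hf hr hrev) _ hcent hne
  obtain ⟨h0', ht'⟩ := minNonzeroEigenvalue_mem h0 ht
  rw [sum_mul_flipGen hrev, hsq] at hle
  simp only [sub_sub_sub_cancel_right] at hle
  constructor
  · obtain ⟨v, hv0, -, hv2⟩ := exists_eigenvalue_eq_rayleigh hrev h0' ht'
    have h2 := sum_mul_sq_pos hf hv0
    have h3 : 0 ≤ ∑ i, ∑ γ, f γ * r i γ * (v γ - v (switch γ i)) ^ 2 :=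
      Finset.sum_nonneg fun i _ => Finset.sum_nonneg fun γ _ =>
        mul_nonneg (mul_pos (hf γ) (hr i γ)).le (sq_nonneg _)
    refine lt_of_le_of_ne ?_ h0'.symm
    by_contra! hlt
    nlinarith
  · exact (mul_le_mul_of_nonneg_right (minNonzeroEigenvalue_le h0 ht) hvar.le).trans hle

end Switching

/-! ### The samplers as switching dynamics -/

section Generators

variable {ι : Type*} [DecidableEq ι] {f : (ι → Bool) → ℝ}

theorem update_eq_switch {γ : ι → Bool} {i : ι} {b : Bool} (h : γ i = !b) :
    Function.update γ i b = switch γ i := by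
  rw [switch, h, Bool.not_not]

theorem update_eq_of_eq {γ : ι → Bool} {i : ι} {b : Bool} (h : γ i = b) :
    Function.update γ i b = γ := by
  rw [← h, Function.update_eq_self]

theorem condProb_eq (i : ι) (b : Bool) (γ : ι → Bool) :
    condProb f i b γ = f (Function.update γ i b) / (f γ + f (switch γ i)) := by
  rw [condProb, Fintype.sum_bool, add_update_eq_add_switch f]

theorem condProb_self (i : ι) (γ : ι → Bool) :
    condProb f i (γ i) γ = f γ / (f γ + f (switch γ i)) := by
  rw [condProb_eq, Function.update_eq_self]

theorem condProb_not (i : ι) (γ : ι → Bool) :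
    condProb f i (!γ i) γ = f (switch γ i) / (f γ + f (switch γ i)) := by
  rw [condProb_eq, switch]

theorem acceptProb_eq (hf : ∀ γ, 0 < f γ) (i : ι) (γ : ι → Bool) :
    acceptProb f i γ = min 1 (f (switch γ i) / f γ) := by
  have h1 := hf γ
  have h2 := hf (switch γ i)
  rw [acceptProb, condProb_self, condProb_not]
  congr 1
  field_simp

theorem selWeight_eq (hf : ∀ γ, 0 < f γ) (η : ι → (ι → Bool) → ℝ) (i : ι) (γ : ι → Bool) :
    selWeight f η i γ = η i γ * ((f γ + f (switch γ i)) / (2 * f γ)) := by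
  have h1 := hf γ
  rw [selWeight, condProb_self]
  field_simp

/-- The identity matrix as an average over the scanned coordinate. -/
theorem one_apply_eq_sum {S ι : Type*} [DecidableEq S] [Fintype ι] [Nonempty ι] (x y : S) :
    (1 : Matrix S S ℝ) x y = ∑ _i : ι, (1 / (Fintype.card ι : ℝ)) * if y = x then 1 else 0 := by
  have h : (Fintype.card ι : ℝ) ≠ 0 := by positivity
  rw [Finset.sum_const, Finset.card_univ, nsmul_eq_mul, Matrix.one_apply]
  simp only [eq_comm (a := x)]
  field_simp

variable [Fintype ι]

theorem one_sub_gibbsKernel [Nonempty ι] (hf : ∀ γ, 0 < f γ) :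
    1 - gibbsKernel f = flipGen fun i γ =>
      1 / (Fintype.card ι : ℝ) * (f (switch γ i) / (f γ + f (switch γ i))) := by
  ext γ γ'
  rw [Matrix.sub_apply, one_apply_eq_sum (ι := ι), gibbsKernel, flipGen, Matrix.of_apply,
    Matrix.of_apply, ← Finset.sum_sub_distrib]
  refine Finset.sum_congr rfl fun i _ => ?_
  have h1 : ∑ b : Bool, condProb f i b γ * (if γ' = Function.update γ i b then (1 : ℝ) else 0) =
      condProb f i (γ i) γ * (if γ' = γ then 1 else 0) +
        condProb f i (!γ i) γ * (if γ' = switch γ i then 1 else 0) := by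
    rw [Fintype.sum_bool]
    have h2 : Function.update γ i (γ i) = γ := Function.update_eq_self i γ
    cases hb : γ i
    · rw [hb] at h2
      rw [switch, hb, h2, add_comm]; rfl
    · rw [hb] at h2
      rw [switch, hb, h2]; rfl
  have hγ := hf γ
  have hs := hf (switch γ i)
  have h3 : f γ / (f γ + f (switch γ i)) = 1 - f (switch γ i) / (f γ + f (switch γ i)) := by
    field_simp
    ring
  rw [h1, condProb_self, condProb_not, h3]
  ring

theorem one_sub_metropolisedGibbsKernel [Nonempty ι] (hf : ∀ γ, 0 < f γ) :
    1 - metropolisedGibbsKernel f = flipGen fun i γ =>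
      1 / (Fintype.card ι : ℝ) * min 1 (f (switch γ i) / f γ) := by
  ext γ γ'
  rw [Matrix.sub_apply, one_apply_eq_sum (ι := ι), metropolisedGibbsKernel, flipGen,
    Matrix.of_apply, Matrix.of_apply, ← Finset.sum_sub_distrib]
  refine Finset.sum_congr rfl fun i _ => ?_
  rw [acceptProb_eq hf]
  ring

theorem neg_temperedJump [Nonempty ι] (hf : ∀ γ, 0 < f γ) {η : ι → (ι → Bool) → ℝ}
    (hη : ∀ i γ, 0 < η i γ) :
    -temperedJump f η = flipGen fun i γ =>
      (zetaConst f η)⁻¹ * (η i γ * ((f γ + f (switch γ i)) / (2 * f γ))) := by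
  have hsel : ∀ i γ, 0 < selWeight f η i γ := fun i γ => by
    rw [selWeight_eq hf]
    have := hf γ
    have := hf (switch γ i)
    have := hη i γ
    positivity
  have hrate : ∀ γ γ', Zfun f η γ * temperedKernel f η γ γ' =
      ∑ i, (zetaConst f η)⁻¹ * selWeight f η i γ * if γ' = switch γ i then 1 else 0 := by
    intro γ γ'
    have hpos : 0 < ∑ i, selWeight f η i γ :=
      Finset.sum_pos (fun i _ => hsel i γ) Finset.univ_nonempty
    rw [Zfun, temperedKernel, Matrix.of_apply, Finset.mul_sum]
    refine Finset.sum_congr rfl fun i _ => ?_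
    field_simp
  ext γ γ'
  simp only [← selWeight_eq hf]
  rw [Matrix.neg_apply, temperedJump, Matrix.of_apply, flipGen, Matrix.of_apply]
  split_ifs with h
  · subst h
    rw [neg_neg]
    simp only [hrate]
    rw [Finset.sum_comm]
    refine Finset.sum_congr rfl fun i _ => ?_
    rw [← Finset.mul_sum, Finset.sum_ite_eq', if_pos (by simp [switch_ne]),
      if_neg (switch_ne γ' i).symm]
    ring
  · rw [hrate, ← Finset.sum_neg_distrib]
    refine Finset.sum_congr rfl fun i _ => ?_
    ring

end Generators

/-! ### Bottleneck bounds for the Gibbs samplers and tempered Gibbs sampling -/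

section Collinear

variable {ι : Type*} [DecidableEq ι] [Fintype ι]

/-- A positive probability mass function on `ι → Bool` under which activating a coordinate
multiplies the mass by `a`, except that activating the first coordinate of the block `S`
multiplies it by `a * B`. Hence the coordinates outside `S` are independent of all the others. -/
structure IsCollinearPMF (S : Finset ι) (a B : ℝ) (f : (ι → Bool) → ℝ) : Prop where
  odds_pos : 0 < a
  boost_pos : 0 < B
  pos : ∀ γ, 0 < f γ
  sum_eq_one : ∑ γ, f γ = 1
  update_free : ∀ j ∉ S, ∀ γ, f (Function.update γ j true) = a * f (Function.update γ j false)
  update_of_active : ∀ i ∈ S, ∀ j, i ≠ j → ∀ γ : ι → Bool, γ i = true →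
    f (Function.update γ j true) = a * f (Function.update γ j false)
  update_of_inactive : ∀ j ∈ S, ∀ γ : ι → Bool, (∀ i ∈ S, i ≠ j → γ i = false) →
    f (Function.update γ j true) = a * B * f (Function.update γ j false)

/-- The event that `i₀` is the only active coordinate of the block `S`. -/
def OnlyActive (S : Finset ι) (i₀ : ι) (γ : ι → Bool) : Prop :=
  γ i₀ = true ∧ ∀ i ∈ S, i ≠ i₀ → γ i = false

instance (S : Finset ι) (i₀ : ι) : DecidablePred (OnlyActive S i₀) := fun γ => by
  unfold OnlyActive; infer_instance

variable {S : Finset ι} {a B : ℝ} {f : (ι → Bool) → ℝ}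

theorem zetaConst_etaTGS (hf1 : ∑ γ, f γ = 1) : zetaConst f etaTGS = Fintype.card ι := by
  simp [zetaConst, expect, etaTGS, hf1]

namespace IsCollinearPMF

theorem mass_switch_of_onlyActive (H : IsCollinearPMF S a B f) {i₀ i : ι} (h₀ : i₀ ∈ S)
    (hne : i ≠ i₀) (hi : i ∈ S) {γ : ι → Bool} (hγ : OnlyActive S i₀ γ) :
    f (switch γ i) = a * f γ := by
  have h1 := H.update_of_active i₀ h₀ i hne.symm γ hγ.1
  have h2 : γ i = false := hγ.2 i hi hne
  rwa [update_eq_of_eq h2, update_eq_switch h2] at h1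

theorem mass_eq_of_onlyActive (H : IsCollinearPMF S a B f) {i₀ : ι} (h₀ : i₀ ∈ S)
    {γ : ι → Bool} (hγ : OnlyActive S i₀ γ) : f γ = a * B * f (switch γ i₀) := by
  have h1 := H.update_of_inactive i₀ h₀ γ hγ.2
  rwa [update_eq_of_eq hγ.1, update_eq_switch (b := false) hγ.1] at h1

/-- By symmetry between two coordinates of `S`, each is the only active one with probability at
most `1 / 2`. -/
theorem sum_onlyActive_le_half (H : IsCollinearPMF S a B f) {i₀ i₁ : ι} (h₀ : i₀ ∈ S)
    (h₁ : i₁ ∈ S) (hne : i₁ ≠ i₀) :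
    ∑ γ, f γ * (if OnlyActive S i₀ γ then 1 else 0) ≤ 1 / 2 := by
  have hswap : ∑ γ, f γ * (if OnlyActive S i₀ γ then (1 : ℝ) else 0) ≤
      ∑ γ, f γ * (if OnlyActive S i₁ γ then 1 else 0) := by
    rw [← sum_switch i₁ fun γ => f γ * (if OnlyActive S i₁ γ then (1 : ℝ) else 0),
      ← sum_switch i₀ fun γ =>
        f (switch γ i₁) * (if OnlyActive S i₁ (switch γ i₁) then (1 : ℝ) else 0)]
    refine Finset.sum_le_sum fun γ _ => ?_
    by_cases hγ : OnlyActive S i₀ γ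
    · have h01 : γ i₁ = false := hγ.2 i₁ h₁ hne
      have hact : OnlyActive S i₁ (switch (switch γ i₀) i₁) := by
        refine ⟨by simp [switch_apply_self, switch_apply_of_ne _ hne, h01], fun i hi hi1 => ?_⟩
        rw [switch_apply_of_ne _ hi1]
        by_cases hi0 : i = i₀
        · subst hi0; simp [switch_apply_self, hγ.1]
        · rw [switch_apply_of_ne _ hi0]; exact hγ.2 i hi hi0
      have hm : f (switch (switch γ i₀) i₁) = f γ := by
        rw [H.mass_eq_of_onlyActive h₁ hact, switch_switch, ← H.mass_eq_of_onlyActive h₀ hγ]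
      rw [if_pos hγ, if_pos hact, hm]
    · rw [if_neg hγ, mul_zero]
      exact mul_nonneg (H.pos _).le (by split_ifs <;> norm_num)
  have hsum : ∑ γ, f γ * (if OnlyActive S i₀ γ then (1 : ℝ) else 0) +
      ∑ γ, f γ * (if OnlyActive S i₁ γ then 1 else 0) ≤ 1 := by
    refine le_of_le_of_eq ?_ H.sum_eq_one
    rw [← Finset.sum_add_distrib]
    refine Finset.sum_le_sum fun γ _ => ?_
    have := H.pos γ
    by_cases hγ : OnlyActive S i₀ γ
    · have h2 : ¬ OnlyActive S i₁ γ := fun h => by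
        have := h.2 i₀ h₀ hne.symm
        rw [hγ.1] at this
        exact Bool.noConfusion this
      simp [hγ, h2]
    · rw [if_neg hγ]
      split_ifs <;> linarith
  linarith

/-- Bottleneck bound: if every coordinate of `S` is switched at rate at most `ρ` on the event that
`i₀` is the only active coordinate of `S`, then the relaxation time is at least
`1 / (2 * #S * ρ)`. -/
theorem le_inv_gap (H : IsCollinearPMF S a B f) {i₀ i₁ : ι} (h₀ : i₀ ∈ S)
    (h₁ : i₁ ∈ S) (hne : i₁ ≠ i₀) {r : ι → (ι → Bool) → ℝ} (hr : ∀ i γ, 0 < r i γ)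
    (hrev : ∀ i γ, f γ * r i γ = f (switch γ i) * r i (switch γ i)) {ρ : ℝ}
    (hρ : ∀ i ∈ S, ∀ γ, OnlyActive S i₀ γ → r i γ ≤ ρ) :
    (2 * S.card * ρ)⁻¹ ≤ (minNonzeroEigenvalue (flipGen r))⁻¹ := by
  set g : (ι → Bool) → ℝ := fun γ => if OnlyActive S i₀ γ then 1 else 0 with hg
  have hg01 : ∀ γ, g γ = 0 ∨ g γ = 1 := fun γ => by
    simp only [hg]; split_ifs <;> simp
  have hg2 : ∀ γ, g γ ^ 2 = g γ := fun γ => by rcases hg01 γ with h | h <;> simp [h]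
  have hhalf : ∑ γ, f γ * g γ ≤ 1 / 2 := H.sum_onlyActive_le_half h₀ h₁ hne
  have hpos : 0 < ∑ γ, f γ * g γ := by
    have hact : OnlyActive S i₀ (fun i => decide (i = i₀)) :=
      ⟨by simp, fun i _ hi => by simp [hi]⟩
    refine Finset.sum_pos' (fun γ _ => mul_nonneg (H.pos γ).le ?_)
      ⟨_, Finset.mem_univ (fun i => decide (i = i₀)), ?_⟩
    · rcases hg01 γ with h | h <;> simp [h]
    · simp only [hg, if_pos hact, mul_one]
      exact H.pos _
  have hD : ∀ i, ∑ γ, f γ * r i γ * (g γ - g (switch γ i)) ^ 2 ≤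
      if i ∈ S then 2 * (ρ * ∑ γ, f γ * g γ) else 0 := by
    intro i
    split_ifs with hi
    · have hdis : ∀ γ, g γ * g (switch γ i) = 0 := by
        intro γ
        simp only [hg]
        by_cases hA : OnlyActive S i₀ γ
        · by_cases hA' : OnlyActive S i₀ (switch γ i)
          · exfalso
            by_cases hii : i = i₀
            · subst hii
              have := hA'.1
              rw [switch_apply_self, hA.1] at this
              exact Bool.noConfusion this
            · have := hA'.2 i hi hii
              rw [switch_apply_self, hA.2 i hi hii] at this
              exact Bool.noConfusion this
          · simp [hA']
        · simp [hA]
      have hexp : ∀ γ, f γ * r i γ * (g γ - g (switch γ i)) ^ 2 =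
          f γ * r i γ * g γ + f (switch γ i) * r i (switch γ i) * g (switch γ i) := by
        intro γ
        rw [← hrev]
        have h1 := hg2 γ
        have h2 := hg2 (switch γ i)
        have h3 := hdis γ
        linear_combination f γ * r i γ * (h1 + h2 - 2 * h3)
      simp only [hexp, Finset.sum_add_distrib]
      rw [sum_switch i fun γ => f γ * r i γ * g γ, ← two_mul]
      refine mul_le_mul_of_nonneg_left ?_ zero_le_two
      rw [Finset.mul_sum]
      refine Finset.sum_le_sum fun γ _ => ?_
      by_cases hA : OnlyActive S i₀ γ
      · simp only [hg, if_pos hA, mul_one]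
        rw [mul_comm]
        exact mul_le_mul_of_nonneg_right (hρ i hi γ hA) (H.pos γ).le
      · simp [hg, hA]
    · refine (Finset.sum_eq_zero fun γ _ => ?_).le
      have hiff : OnlyActive S i₀ (switch γ i) ↔ OnlyActive S i₀ γ := by
        have hj : ∀ j ∈ S, switch γ i j = γ j := fun j hj =>
          switch_apply_of_ne _ fun h => hi (h ▸ hj)
        unfold OnlyActive
        rw [hj i₀ h₀]
        exact and_congr_right fun _ => forall₂_congr fun j hjS => by rw [hj j hjS]
      simp [hg, hiff]
  have hvar : 0 < ∑ γ, f γ * g γ ^ 2 - (∑ γ, f γ * g γ) ^ 2 := by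
    simp only [hg2]
    nlinarith
  obtain ⟨hgap, hle⟩ := gap_pos_and_gap_mul_variance_le H.pos H.sum_eq_one hr hrev g hvar
  refine inv_anti₀ hgap ?_
  have hsum := Finset.sum_le_sum fun i (_ : i ∈ Finset.univ) => hD i
  rw [Finset.sum_ite_mem, Finset.univ_inter, Finset.sum_const, nsmul_eq_mul] at hsum
  simp only [hg2] at hle
  set e := ∑ γ, f γ * g γ
  have h1 : minNonzeroEigenvalue (flipGen r) * (e * (1 - e)) ≤ S.card * ρ * e := by
    nlinarith
  have h2 : minNonzeroEigenvalue (flipGen r) * (1 - e) ≤ S.card * ρ := by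
    refine le_of_mul_le_mul_right ?_ hpos
    linarith
  nlinarith

/-- On the event that `i₀` is the only active coordinate of `S`, switching a coordinate of `S`
multiplies the mass by at most `K * a`. -/
theorem mass_switch_le (H : IsCollinearPMF S a B f) {K : ℝ} (hK : 1 ≤ K)
    (hKB : 1 ≤ K * (a ^ 2 * B)) {i₀ i : ι} (h₀ : i₀ ∈ S) (hi : i ∈ S) {γ : ι → Bool}
    (hγ : OnlyActive S i₀ γ) : f (switch γ i) ≤ K * a * f γ := by
  have ha := H.odds_pos
  by_cases h : i = i₀
  · subst h
    rw [H.mass_eq_of_onlyActive h₀ hγ]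
    have := H.pos (switch γ i)
    nlinarith
  · rw [H.mass_switch_of_onlyActive h₀ h hi hγ]
    have := H.pos γ
    have : 0 < a * f γ := by positivity
    nlinarith

theorem le_relaxGS [Nonempty ι] (H : IsCollinearPMF S a B f) {K : ℝ} (hK : 1 ≤ K)
    (hKB : 1 ≤ K * (a ^ 2 * B)) {i₀ i₁ : ι} (h₀ : i₀ ∈ S) (h₁ : i₁ ∈ S) (hne : i₁ ≠ i₀) :
    (2 * S.card * (1 / (Fintype.card ι : ℝ) * (K * a)))⁻¹ ≤ relaxGS f := by
  rw [relaxGS, kernelGap, one_sub_gibbsKernel H.pos]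
  refine H.le_inv_gap h₀ h₁ hne (fun i γ => ?_) (fun i γ => ?_) fun i hi γ hγ => ?_
  · have := H.pos γ
    have := H.pos (switch γ i)
    positivity
  · rw [switch_switch, add_comm (f (switch γ i))]
    ring
  · refine mul_le_mul_of_nonneg_left ?_ (by positivity)
    have h1 := H.pos γ
    have h2 := H.pos (switch γ i)
    rw [div_le_iff₀ (by positivity)]
    refine (H.mass_switch_le hK hKB h₀ hi hγ).trans ?_
    have := H.odds_pos
    have : 0 < K * a := by positivity
    exact mul_le_mul_of_nonneg_left (by linarith) this.le

theorem le_relaxMetropolisedGS [Nonempty ι] (H : IsCollinearPMF S a B f) {K : ℝ} (hK : 1 ≤ K)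
    (hKB : 1 ≤ K * (a ^ 2 * B)) {i₀ i₁ : ι} (h₀ : i₀ ∈ S) (h₁ : i₁ ∈ S) (hne : i₁ ≠ i₀) :
    (2 * S.card * (1 / (Fintype.card ι : ℝ) * (K * a)))⁻¹ ≤ relaxMetropolisedGS f := by
  rw [relaxMetropolisedGS, kernelGap, one_sub_metropolisedGibbsKernel H.pos]
  refine H.le_inv_gap h₀ h₁ hne (fun i γ => ?_) (fun i γ => ?_) fun i hi γ hγ => ?_
  · have := H.pos γ
    have := H.pos (switch γ i)
    have : 0 < min 1 (f (switch γ i) / f γ) := lt_min one_pos (by positivity)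
    positivity
  · have h1 := H.pos γ
    have h2 := H.pos (switch γ i)
    have h3 : ∀ x y : ℝ, 0 < x → x * min 1 (y / x) = min x y := fun x y hx => by
      rw [mul_min_of_nonneg _ _ hx.le, mul_one, mul_div_cancel₀ _ hx.ne']
    rw [switch_switch, mul_left_comm, h3 _ _ h1, mul_left_comm, h3 _ _ h2, min_comm]
  · refine mul_le_mul_of_nonneg_left ((min_le_right _ _).trans ?_) (by positivity)
    rw [div_le_iff₀ (H.pos γ)]
    exact H.mass_switch_le hK hKB h₀ hi hγ

theorem le_relaxTGS [Nonempty ι] (H : IsCollinearPMF S a B f) {K : ℝ} (hK : 1 ≤ K)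
    (hKB : 1 ≤ K * (a ^ 2 * B)) {i₀ i₁ : ι} (h₀ : i₀ ∈ S) (h₁ : i₁ ∈ S) (hne : i₁ ≠ i₀) :
    (2 * S.card * ((Fintype.card ι : ℝ)⁻¹ * ((1 + K * a) / 2)))⁻¹ ≤ relaxTGS f := by
  rw [relaxTGS, jumpGap, neg_temperedJump H.pos (η := etaTGS) (fun _ _ => one_pos),
    zetaConst_etaTGS H.sum_eq_one]
  refine H.le_inv_gap h₀ h₁ hne (fun i γ => ?_) (fun i γ => ?_) fun i hi γ hγ => ?_
  · have := H.pos γ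
    have := H.pos (switch γ i)
    simp only [etaTGS]
    positivity
  · have h1 := H.pos γ
    have h2 := H.pos (switch γ i)
    simp only [etaTGS]
    rw [switch_switch]
    field_simp
    ring
  · refine mul_le_mul_of_nonneg_left ?_ (by positivity)
    have h1 := H.pos γ
    have h2 := H.mass_switch_le hK hKB h₀ hi hγ
    simp only [etaTGS, one_mul]
    rw [div_le_div_iff₀ (by positivity) two_pos]
    nlinarith

end IsCollinearPMF

end Collinear

/-! ### A Poincaré inequality for the posterior -/

section Poincare

variable {ι : Type*} [DecidableEq ι]

/-- The average of `g` over the coordinate `j`, drawn with odds `a` of being active. -/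
noncomputable def coordAvg (a : ℝ) (j : ι) (g : (ι → Bool) → ℝ) (γ : ι → Bool) : ℝ :=
  (a * g (Function.update γ j true) + g (Function.update γ j false)) / (1 + a)

theorem coordAvg_update (a : ℝ) (j : ι) (g : (ι → Bool) → ℝ) (γ : ι → Bool) (b : Bool) :
    coordAvg a j g (Function.update γ j b) = coordAvg a j g γ := by
  simp [coordAvg]

theorem coordAvg_switch_self (a : ℝ) (j : ι) (g : (ι → Bool) → ℝ) (γ : ι → Bool) :
    coordAvg a j g (switch γ j) = coordAvg a j g γ :=
  coordAvg_update a j g γ _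

theorem update_switch_comm (γ : ι → Bool) {i j : ι} (h : i ≠ j) (b : Bool) :
    Function.update (switch γ i) j b = switch (Function.update γ j b) i := by
  rw [switch, switch, Function.update_comm h, Function.update_of_ne h]

/-- The configuration `γ` with all coordinates in `T` made inactive. -/
def deactivate (T : Finset ι) (γ : ι → Bool) : ι → Bool := fun i => if i ∈ T then false else γ i

theorem deactivate_insert (T : Finset ι) (j : ι) (γ : ι → Bool) :
    deactivate (insert j T) γ = deactivate T (Function.update γ j false) := by
  ext i
  by_cases h : i = j
  · subst h; simp [deactivate]
  · simp [deactivate, h]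

variable [Fintype ι]

/-- The energy of `g` along the edges in direction `i`, each edge being charged with the mass of its
endpoint at which `i` is active. Every edge is counted twice. -/
def edgeEnergy (f g : (ι → Bool) → ℝ) (i : ι) : ℝ :=
  ∑ γ, f (Function.update γ i true) *
    (g (Function.update γ i true) - g (Function.update γ i false)) ^ 2

variable {S : Finset ι} {a B : ℝ} {f : (ι → Bool) → ℝ}

theorem edgeEnergy_coordAvg_self (g : (ι → Bool) → ℝ) (j : ι) :
    edgeEnergy f (coordAvg a j g) j = 0 := by
  simp [edgeEnergy, coordAvg_update]

namespace IsCollinearPMF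

theorem edgeEnergy_nonneg (H : IsCollinearPMF S a B f) (g : (ι → Bool) → ℝ) (i : ι) :
    0 ≤ edgeEnergy f g i :=
  Finset.sum_nonneg fun _ _ => mul_nonneg (H.pos _).le (sq_nonneg _)

theorem sum_mul_coordAvg (H : IsCollinearPMF S a B f) {j : ι} (hj : j ∉ S)
    (g : (ι → Bool) → ℝ) : ∑ γ, f γ * coordAvg a j g γ = ∑ γ, f γ * g γ := by
  rw [sum_eq_half_sum_update j, sum_eq_half_sum_update j fun γ => f γ * g γ]
  congr 1
  refine Finset.sum_congr rfl fun γ _ => ?_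
  have ha := H.odds_pos
  rw [coordAvg_update, coordAvg_update, H.update_free j hj, coordAvg]
  field_simp
  ring

theorem sum_mul_sq_le_coordAvg (H : IsCollinearPMF S a B f) {j : ι} (hj : j ∉ S)
    (g : (ι → Bool) → ℝ) :
    2 * ∑ γ, f γ * g γ ^ 2 ≤ 2 * ∑ γ, f γ * coordAvg a j g γ ^ 2 + edgeEnergy f g j := by
  rw [sum_eq_half_sum_update j, sum_eq_half_sum_update j fun γ => f γ * coordAvg a j g γ ^ 2,
    ← mul_assoc, ← mul_assoc, mul_one_div_cancel two_ne_zero, one_mul, one_mul, edgeEnergy,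
    ← Finset.sum_add_distrib]
  refine Finset.sum_le_sum fun γ _ => ?_
  have ha := H.odds_pos
  have hf := H.pos (Function.update γ j false)
  rw [coordAvg_update, coordAvg_update, H.update_free j hj, coordAvg]
  set x := g (Function.update γ j true)
  set y := g (Function.update γ j false)
  have key : a * x ^ 2 + y ^ 2 ≤
      (1 + a) * ((a * x + y) / (1 + a)) ^ 2 + a * (x - y) ^ 2 := by
    have h1 : (1 + a) * ((a * x + y) / (1 + a)) ^ 2 + a * (x - y) ^ 2 - (a * x ^ 2 + y ^ 2) =
        a ^ 2 * (x - y) ^ 2 / (1 + a) := by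
      field_simp
      ring
    have h2 : 0 ≤ a ^ 2 * (x - y) ^ 2 / (1 + a) := by positivity
    linarith
  have := mul_le_mul_of_nonneg_left key hf.le
  linarith

/-- Averaging over an independent coordinate contracts the energy, by convexity of the square. -/
theorem edgeEnergy_coordAvg_le (H : IsCollinearPMF S a B f) {i j : ι} (hj : j ∉ S) (hij : i ≠ j)
    (g : (ι → Bool) → ℝ) : edgeEnergy f (coordAvg a j g) i ≤ edgeEnergy f g i := by
  rw [edgeEnergy, edgeEnergy, sum_eq_half_sum_update j, sum_eq_half_sum_update j
    fun γ => f (Function.update γ i true) *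
      (g (Function.update γ i true) - g (Function.update γ i false)) ^ 2]
  refine mul_le_mul_of_nonneg_left (Finset.sum_le_sum fun γ _ => ?_) (by norm_num)
  have ha := H.odds_pos
  simp only [Function.update_comm hij.symm]
  simp only [coordAvg_update]
  rw [H.update_free j hj]
  have hf := H.pos (Function.update (Function.update γ i true) j false)
  simp only [coordAvg]
  set x := g (Function.update (Function.update γ i true) j true)
  set y := g (Function.update (Function.update γ i true) j false)
  set x' := g (Function.update (Function.update γ i false) j true)
  set y' := g (Function.update (Function.update γ i false) j false)
  have key : (1 + a) * ((a * x + y) / (1 + a) - (a * x' + y') / (1 + a)) ^ 2 ≤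
      a * (x - x') ^ 2 + (y - y') ^ 2 := by
    have h1 : a * (x - x') ^ 2 + (y - y') ^ 2 -
        (1 + a) * ((a * x + y) / (1 + a) - (a * x' + y') / (1 + a)) ^ 2 =
        a * ((x - x') - (y - y')) ^ 2 / (1 + a) := by
      field_simp
      ring
    have h2 : 0 ≤ a * ((x - x') - (y - y')) ^ 2 / (1 + a) := by positivity
    linarith
  have := mul_le_mul_of_nonneg_left key hf.le
  linarith

/-- A Poincaré inequality for functions which do not depend on the independent coordinates `T`
extends to all functions. -/
theorem poincare_of_invariant (H : IsCollinearPMF S a B f) {C : ℝ} (hC : 1 ≤ C) (T : Finset ι)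
    (hT : ∀ j ∈ T, j ∉ S)
    (hP : ∀ g : (ι → Bool) → ℝ, (∀ j ∈ T, ∀ γ, g (switch γ j) = g γ) → ∑ γ, f γ * g γ = 0 →
      2 * ∑ γ, f γ * g γ ^ 2 ≤ C * ∑ i, edgeEnergy f g i)
    (g : (ι → Bool) → ℝ) (hg : ∑ γ, f γ * g γ = 0) :
    2 * ∑ γ, f γ * g γ ^ 2 ≤ C * ∑ i, edgeEnergy f g i := by
  induction T using Finset.induction_on generalizing g with
  | empty => exact hP g (by simp) hg
  | insert j T hjT ih =>
    refine ih (fun i hi => hT i (Finset.mem_insert_of_mem hi)) (fun g hginv hg => ?_) g hg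
    have hj : j ∉ S := hT j (Finset.mem_insert_self j T)
    have h1 := hP (coordAvg a j g) (fun i hi γ => ?_) (by rw [H.sum_mul_coordAvg hj, hg])
    · have h2 := H.sum_mul_sq_le_coordAvg hj g
      rw [← Finset.add_sum_erase _ _ (Finset.mem_univ j), edgeEnergy_coordAvg_self,
        zero_add] at h1
      rw [← Finset.add_sum_erase _ _ (Finset.mem_univ j)]
      have h3 : ∑ i ∈ Finset.univ.erase j, edgeEnergy f (coordAvg a j g) i ≤
          ∑ i ∈ Finset.univ.erase j, edgeEnergy f g i :=
        Finset.sum_le_sum fun i hi =>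
          H.edgeEnergy_coordAvg_le hj (Finset.ne_of_mem_erase hi) g
      have h4 := H.edgeEnergy_nonneg g j
      nlinarith
    · by_cases hij : i = j
      · subst hij; exact coordAvg_switch_self a i g γ
      · have hiT : i ∈ T := (Finset.mem_insert.1 hi).resolve_left hij
        simp only [coordAvg, update_switch_comm γ hij, hginv i hiT]

/-- Deactivating the coordinates of `T ⊆ S` one at a time: as long as some coordinate of `S` remains
active, deactivating another one does not decrease the mass when `a ≤ 1`. -/
theorem sum_mul_sub_deactivate_sq_le (H : IsCollinearPMF S a B f) (ha1 : a ≤ 1)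
    (g : (ι → Bool) → ℝ) (T : Finset ι) (hT : T ⊆ S) :
    2 * ∑ γ, f γ * (g γ - g (deactivate T γ)) ^ 2 ≤
      4 ^ T.card * ∑ i ∈ T, edgeEnergy f g i := by
  induction T using Finset.induction_on with
  | empty =>
    have h : ∀ γ : ι → Bool, deactivate ∅ γ = γ := fun γ => by ext i; simp [deactivate]
    simp [h]
  | insert j T hjT ih =>
    replace ih := ih ((Finset.subset_insert j T).trans hT)
    set F : (ι → Bool) → ℝ := fun γ => (g γ - g (deactivate T γ)) ^ 2 with hF
    have hF0 : ∀ γ, 0 ≤ F γ := fun γ => sq_nonneg _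
    have h1 : ∑ γ, f γ * (g γ - g (deactivate (insert j T) γ)) ^ 2 ≤
        2 * ∑ γ, f γ * (g γ - g (Function.update γ j false)) ^ 2 +
          2 * ∑ γ, f γ * F (Function.update γ j false) := by
      rw [Finset.mul_sum, Finset.mul_sum, ← Finset.sum_add_distrib]
      refine Finset.sum_le_sum fun γ _ => ?_
      rw [deactivate_insert]
      have := mul_le_mul_of_nonneg_left (add_sq_le (a := g γ - g (Function.update γ j false))
        (b := g (Function.update γ j false) - g (deactivate T (Function.update γ j false))))
        (H.pos γ).le
      rw [sub_add_sub_cancel] at this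
      simp only [hF]
      linarith
    have h2 : ∑ γ, f γ * (g γ - g (Function.update γ j false)) ^ 2 =
        (1 / 2) * edgeEnergy f g j := by
      rw [sum_eq_half_sum_update j]
      simp [edgeEnergy]
    have h3 : ∑ γ, f γ * F (Function.update γ j false) ≤ 2 * ∑ γ, f γ * F γ := by
      rw [sum_eq_half_sum_update j, sum_eq_half_sum_update j fun γ => f γ * F γ, mul_left_comm]
      refine mul_le_mul_of_nonneg_left ?_ (by norm_num)
      rw [Finset.mul_sum]
      refine Finset.sum_le_sum fun γ _ => ?_
      rw [Function.update_idem, Function.update_idem]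
      have hle : f (Function.update γ j true) * F (Function.update γ j false) ≤
          f (Function.update γ j false) * F (Function.update γ j false) := by
        by_cases hact : ∃ i ∈ T, γ i = true
        · obtain ⟨i, hi, hγi⟩ := hact
          have hij : i ≠ j := fun h => hjT (h ▸ hi)
          refine mul_le_mul_of_nonneg_right ?_ (hF0 _)
          rw [H.update_of_active i (hT (Finset.mem_insert_of_mem hi)) j hij γ hγi]
          exact mul_le_of_le_one_left (H.pos _).le ha1
        · have hz : F (Function.update γ j false) = 0 := by
            have : deactivate T (Function.update γ j false) = Function.update γ j false := by
              ext i
              simp only [deactivate]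
              split_ifs with hi
              · rw [Function.update_of_ne (fun h : i = j => hjT (h ▸ hi))]
                cases hγi : γ i
                · rfl
                · exact absurd ⟨i, hi, hγi⟩ hact
              · rfl
            simp [hF, this]
          simp [hz]
      have := mul_nonneg (H.pos (Function.update γ j true)).le (hF0 (Function.update γ j true))
      linarith
    rw [Finset.sum_insert hjT, Finset.card_insert_of_notMem hjT, pow_succ]
    have h4 := H.edgeEnergy_nonneg g j
    have h5 : (1 : ℝ) ≤ 4 ^ T.card := one_le_pow₀ (by norm_num)
    have h6 : edgeEnergy f g j ≤ 4 ^ T.card * edgeEnergy f g j := le_mul_of_one_le_left h4 h5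
    linarith

/-- For a centred `g`, the energy charges every edge with the mass of its larger endpoint, and the
constant depends only on the size of the block `S`. -/
theorem poincare (H : IsCollinearPMF S a B f) (ha1 : a ≤ 1)
    (g : (ι → Bool) → ℝ) (hg : ∑ γ, f γ * g γ = 0) :
    2 * ∑ γ, f γ * g γ ^ 2 ≤ 4 ^ S.card * ∑ i, edgeEnergy f g i := by
  refine H.poincare_of_invariant (one_le_pow₀ (by norm_num)) (Finset.univ \ S) (by simp)
    (fun g hinv hg => ?_) g hg
  have hconst : ∀ γ γ', g (deactivate S γ) = g (deactivate S γ') := by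
    refine eq_of_forall_switch (g := fun γ => g (deactivate S γ)) fun i γ => ?_
    by_cases hi : i ∈ S
    · congr 1
      ext j
      simp only [deactivate]
      split_ifs with hj
      · rfl
      · rw [switch_apply_of_ne _ fun h : j = i => hj (h ▸ hi)]
    · have h1 : deactivate S (switch γ i) = switch (deactivate S γ) i := by
        ext j
        by_cases hji : j = i
        · subst hji; simp [deactivate, hi, switch_apply_self]
        · simp [deactivate, switch_apply_of_ne _ hji]
      rw [h1, hinv i (by simpa using hi)]
  set t := g (deactivate S fun _ => false)
  have h1 := H.sum_mul_sub_deactivate_sq_le ha1 g S subset_rfl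
  have h2 : ∑ γ, f γ * (g γ - g (deactivate S γ)) ^ 2 = ∑ γ, f γ * g γ ^ 2 + t ^ 2 := by
    have : ∀ γ, f γ * (g γ - g (deactivate S γ)) ^ 2 =
        f γ * g γ ^ 2 - 2 * t * (f γ * g γ) + f γ * t ^ 2 := fun γ => by
      rw [hconst γ fun _ => false]; ring
    simp only [this, Finset.sum_add_distrib, Finset.sum_sub_distrib, ← Finset.mul_sum,
      ← Finset.sum_mul, hg, H.sum_eq_one]
    ring
  have h3 : ∑ i ∈ S, edgeEnergy f g i ≤ ∑ i, edgeEnergy f g i :=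
    Finset.sum_le_sum_of_subset_of_nonneg (Finset.subset_univ S)
      fun i _ _ => H.edgeEnergy_nonneg g i
  have h4 := mul_le_mul_of_nonneg_left h3 (by positivity : (0 : ℝ) ≤ 4 ^ S.card)
  have := sq_nonneg t
  linarith

end IsCollinearPMF

/-! ### The relaxation time of weighted tempered Gibbs sampling -/

theorem zetaConst_etaWTGS [Nonempty ι] (hf : ∀ γ, 0 < f γ) (hf1 : ∑ γ, f γ = 1) (k : ℝ) :
    zetaConst f (etaWTGS f k) = expectedSize f + k := by
  have h1 : ∀ i, ∑ γ, f γ * condProb f i true γ = ∑ γ, f γ * (if γ i = true then 1 else 0) := by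
    intro i
    rw [sum_eq_half_sum_update i, sum_eq_half_sum_update i fun γ =>
      f γ * (if γ i = true then (1 : ℝ) else 0)]
    congr 1
    refine Finset.sum_congr rfl fun γ _ => ?_
    have h1 := hf (Function.update γ i true)
    have h2 := hf (Function.update γ i false)
    simp only [condProb, Fintype.sum_bool, Function.update_idem, Function.update_self]
    simp only [Bool.false_eq_true, if_true, if_false]
    field_simp
    ring
  have h2 : ∀ i, expect f (etaWTGS f k i) =
      ∑ γ, f γ * (if γ i = true then 1 else 0) + k / (Fintype.card ι : ℝ) := by
    intro i
    rw [← h1, expect]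
    simp only [etaWTGS, mul_add, Finset.sum_add_distrib, ← Finset.sum_mul, hf1, one_mul]
  have h3 : (Fintype.card ι : ℝ) ≠ 0 := by positivity
  simp only [zetaConst, h2, Finset.sum_add_distrib, Finset.sum_const, Finset.card_univ,
    nsmul_eq_mul]
  rw [mul_div_cancel₀ _ h3, Finset.sum_comm, expectedSize, expect]
  congr 1
  refine Finset.sum_congr rfl fun γ _ => ?_
  rw [← Finset.mul_sum, numActive]
  push_cast
  rfl

namespace IsCollinearPMF

/-- The block `S` is inactive with probability at most `1 / 2`, so at least half a coordinate is
active on average. -/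
theorem half_le_expectedSize (H : IsCollinearPMF S a B f) (haB : 1 ≤ a * B) {i₀ i₁ : ι}
    (h₀ : i₀ ∈ S) (h₁ : i₁ ∈ S) (hne : i₁ ≠ i₀) : 1 / 2 ≤ expectedSize f := by
  have h1 : ∑ γ, f γ * (if ∀ i ∈ S, γ i = false then (1 : ℝ) else 0) ≤
      ∑ γ, f γ * (if OnlyActive S i₀ γ then 1 else 0) := by
    rw [← sum_switch i₀ fun γ => f γ * (if OnlyActive S i₀ γ then (1 : ℝ) else 0)]
    refine Finset.sum_le_sum fun γ _ => ?_
    have hs := H.pos (switch γ i₀)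
    by_cases hγ : ∀ i ∈ S, γ i = false
    · have hact : OnlyActive S i₀ (switch γ i₀) :=
        ⟨by simp [switch_apply_self, hγ i₀ h₀], fun i hi hi0 => by
          rw [switch_apply_of_ne _ hi0, hγ i hi]⟩
      rw [if_pos hγ, if_pos hact, mul_one, mul_one, H.mass_eq_of_onlyActive h₀ hact,
        switch_switch]
      exact le_mul_of_one_le_left (H.pos γ).le haB
    · rw [if_neg hγ, mul_zero]
      exact mul_nonneg hs.le (by split_ifs <;> norm_num)
  have h2 := H.sum_onlyActive_le_half h₀ h₁ hne
  have h3 : (1 : ℝ) ≤ expectedSize f +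
      ∑ γ, f γ * (if ∀ i ∈ S, γ i = false then (1 : ℝ) else 0) := by
    refine le_of_eq_of_le H.sum_eq_one.symm ?_
    rw [expectedSize, expect, ← Finset.sum_add_distrib]
    refine Finset.sum_le_sum fun γ _ => ?_
    rw [← mul_add]
    refine le_mul_of_one_le_right (H.pos γ).le ?_
    split_ifs with hγ
    · have : (0 : ℝ) ≤ numActive γ := Nat.cast_nonneg _
      linarith
    · push Not at hγ
      obtain ⟨i, hi, hγi⟩ := hγ
      have : 1 ≤ numActive γ := by
        rw [numActive]
        refine le_trans ?_ (Finset.single_le_sum (f := fun i => if γ i = true then 1 else 0)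
          (fun _ _ => Nat.zero_le _) (Finset.mem_univ i))
        simp [Bool.eq_true_of_not_eq_false hγi]
      have : (1 : ℝ) ≤ numActive γ := by exact_mod_cast this
      linarith
  linarith

theorem relaxWTGS_le [Nonempty ι] (H : IsCollinearPMF S a B f) (ha1 : a ≤ 1) (haB : 1 ≤ a * B)
    {i₀ i₁ : ι} (h₀ : i₀ ∈ S) (h₁ : i₁ ∈ S) (hne : i₁ ≠ i₀) {k : ℝ} (hk : 0 ≤ k) :
    relaxWTGS f k ≤ 2 * 4 ^ S.card * (1 + 2 * k) * expectedSize f := by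
  have hs := H.half_le_expectedSize haB h₀ h₁ hne
  have hcond : ∀ i γ, condProb f i true γ * (f γ + f (switch γ i)) =
      f (Function.update γ i true) := fun i γ => by
    have := H.pos γ
    have := H.pos (switch γ i)
    rw [condProb_eq]
    field_simp
  have hη : ∀ i γ, 0 < etaWTGS f k i γ := fun i γ => by
    have := H.pos γ
    have := H.pos (switch γ i)
    have := H.pos (Function.update γ i true)
    rw [etaWTGS, condProb_eq]
    positivity
  have hηs : ∀ i γ, etaWTGS f k i (switch γ i) = etaWTGS f k i γ := fun i γ => by
    simp only [etaWTGS, condProb, update_switch]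
  rw [relaxWTGS, jumpGap, neg_temperedJump H.pos hη,
    zetaConst_etaWTGS H.pos H.sum_eq_one]
  have hζ : 0 < expectedSize f + k := by linarith
  refine le_trans (inv_minNonzeroEigenvalue_le (C := 2 * 4 ^ S.card * (expectedSize f + k)) H.pos
    (fun i γ => ?_) (by positivity) fun g hg => ?_) ?_
  · have h1 := H.pos γ
    have h2 := H.pos (switch γ i)
    rw [switch_switch, hηs]
    field_simp
    ring
  · have hP := H.poincare ha1 g hg
    have hE : ∀ i, edgeEnergy f g i ≤ 2 * (expectedSize f + k) * ∑ γ, f γ *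
        ((expectedSize f + k)⁻¹ * (etaWTGS f k i γ * ((f γ + f (switch γ i)) / (2 * f γ)))) *
          (g γ - g (switch γ i)) ^ 2 := by
      intro i
      rw [edgeEnergy, Finset.mul_sum]
      refine Finset.sum_le_sum fun γ _ => ?_
      have h1 := H.pos γ
      have h2 := H.pos (switch γ i)
      have hsq : (g (Function.update γ i true) - g (Function.update γ i false)) ^ 2 =
          (g γ - g (switch γ i)) ^ 2 := by
        cases hb : γ i
        · rw [update_eq_of_eq hb, update_eq_switch (b := true) hb]; ring
        · rw [update_eq_of_eq hb, update_eq_switch (b := false) hb]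
      have hle : f (Function.update γ i true) ≤ etaWTGS f k i γ * (f γ + f (switch γ i)) := by
        rw [← hcond i γ]
        refine mul_le_mul_of_nonneg_right ?_ (by positivity)
        exact le_add_of_nonneg_right (by positivity)
      have heq : 2 * (expectedSize f + k) * (f γ *
          ((expectedSize f + k)⁻¹ * (etaWTGS f k i γ * ((f γ + f (switch γ i)) / (2 * f γ)))) *
            (g γ - g (switch γ i)) ^ 2) =
          etaWTGS f k i γ * (f γ + f (switch γ i)) * (g γ - g (switch γ i)) ^ 2 := by
        field_simp
      rw [heq, hsq]
      exact mul_le_mul_of_nonneg_right hle (sq_nonneg _)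
    have hsum := Finset.sum_le_sum fun i (_ : i ∈ Finset.univ) => hE i
    rw [← Finset.mul_sum] at hsum
    have := mul_le_mul_of_nonneg_left hsum (by positivity : (0 : ℝ) ≤ 4 ^ S.card)
    linarith
  · have h1 : expectedSize f + k ≤ (1 + 2 * k) * expectedSize f := by nlinarith
    have := mul_le_mul_of_nonneg_left h1 (by positivity : (0 : ℝ) ≤ 2 * 4 ^ S.card)
    linarith

end IsCollinearPMF

end Poincare

/-! ### The residual and the posterior under a collinear design -/

section Residual

open Matrix

variable {N ι : Type*} [Fintype N] [Fintype ι] [DecidableEq ι]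

theorem residual_of_orthogonal {X : Matrix N ι ℝ} {Y : N → ℝ} (c : ℝ) {γ : ι → Bool}
    (h : ∀ i, γ i = true → X.col i ⬝ᵥ Y = 0) : residual X Y c γ = Y ⬝ᵥ Y := by
  have h0 : (activeCols X γ)ᵀ *ᵥ Y = 0 := by
    ext ⟨i, hi⟩
    exact h i hi
  simp [residual, h0]

/-- If `Y` is a multiple of an active column, then it lies in the range of `X_γ`, and the fitted
values are `Y` itself. -/
theorem residual_of_collinear {X : Matrix N ι ℝ} {Y : N → ℝ} {c : ℝ} (hc : 0 < c) {γ : ι → Bool}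
    {i : ι} (hi : γ i = true) {α : ℝ} (hα : α ≠ 0) (hX : X.col i = α • Y) :
    residual X Y c γ = (Y ⬝ᵥ Y) / (1 + c) := by
  set A := activeCols X γ
  set v : {i // γ i = true} → ℝ := Pi.single ⟨i, hi⟩ α⁻¹
  have hv : A *ᵥ v = Y := by
    ext x
    have h1 : X x i = α * Y x := congrFun hX x
    simp only [A, v, activeCols, Matrix.mulVec_single]
    simp only [Pi.smul_apply, Matrix.col_apply, Matrix.submatrix_apply, id, h1,
      MulOpposite.smul_eq_mul_unop, MulOpposite.unop_op]
    field_simp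
  have hG : (Aᵀ * A).IsHermitian := by
    simpa using Matrix.isHermitian_conjTranspose_mul_self A
  have hA : Aᵀ *ᵥ Y = (Aᵀ * A) *ᵥ v := by
    rw [← Matrix.mulVec_mulVec, hv]
  have hinv := (symmPinv_generalised_inverse (Aᵀ * A) hG).1
  have hfit : (Aᵀ *ᵥ Y) ⬝ᵥ (symmPinv (Aᵀ * A) *ᵥ (Aᵀ *ᵥ Y)) = Y ⬝ᵥ Y := by
    have h1 : (Aᵀ *ᵥ Y) ⬝ᵥ (symmPinv (Aᵀ * A) *ᵥ (Aᵀ *ᵥ Y)) =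
        v ⬝ᵥ ((Aᵀ * A) *ᵥ (symmPinv (Aᵀ * A) *ᵥ ((Aᵀ * A) *ᵥ v))) := by
      rw [hA, Matrix.dotProduct_mulVec v, ← Matrix.mulVec_transpose, Matrix.transpose_mul,
        Matrix.transpose_transpose]
    rw [h1, Matrix.mulVec_mulVec, Matrix.mulVec_mulVec, hinv,
      ← Matrix.mulVec_mulVec, hv, Matrix.dotProduct_mulVec, Matrix.vecMul_transpose, hv]
  rw [residual, hfit]
  field_simp
  ring

end Residual

section Posterior

variable {ι : Type*} [Fintype ι]

/-- Up to a constant, each active coordinate contributes the factor `h (1 + c)^{-1/2} / (1 - h)`. -/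
theorem prior_mul_rpow_numActive {c h : ℝ} (hc : 0 < c) (hh : h < 1) (γ : ι → Bool) :
    prior h γ * (1 + c) ^ (-((numActive γ : ℝ) / 2)) =
      (1 - h) ^ Fintype.card ι *
        ∏ i, if γ i = true then h * (1 + c) ^ (-(1 / 2) : ℝ) / (1 - h) else 1 := by
  have h1 : (1 + c) ^ (-((numActive γ : ℝ) / 2)) =
      ∏ i, if γ i = true then (1 + c) ^ (-(1 / 2) : ℝ) else 1 := by
    have : ∀ i, (if γ i = true then (1 + c) ^ (-(1 / 2) : ℝ) else 1) =
        ((1 + c) ^ (-(1 / 2) : ℝ)) ^ (if γ i then 1 else 0) := fun i => by split_ifs <;> simp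
    simp only [this]
    rw [Finset.prod_pow_eq_pow_sum, ← Real.rpow_natCast, ← Real.rpow_mul (by linarith), numActive]
    congr 1
    ring
  have h2 : (1 - h) ^ Fintype.card ι = ∏ _i : ι, (1 - h) := by simp
  rw [h1, h2, prior, ← Finset.prod_mul_distrib, ← Finset.prod_mul_distrib]
  refine Finset.prod_congr rfl fun i _ => ?_
  have : 1 - h ≠ 0 := by linarith
  split_ifs
  · field_simp
  · rfl

variable [DecidableEq ι]

theorem prod_update_true (a : ℝ) (γ : ι → Bool) (j : ι) :
    ∏ i, (if Function.update γ j true i = true then a else 1) =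
      a * ∏ i, (if Function.update γ j false i = true then a else 1) := by
  rw [← Finset.mul_prod_erase _ _ (Finset.mem_univ j),
    ← Finset.mul_prod_erase (a := j) _
      (fun i => if Function.update γ j false i = true then a else 1)
      (Finset.mem_univ j)]
  simp only [Function.update_self, Bool.false_eq_true, if_true, if_false, one_mul]
  congr 1
  refine Finset.prod_congr rfl fun i hi => ?_
  have h : i ≠ j := Finset.ne_of_mem_erase hi
  rw [Function.update_of_ne h, Function.update_of_ne h]

/-- Normalising the weights `a ^ |γ|`, boosted by `B` when `S` is active. -/
theorem isCollinearPMF_of_weight {S : Finset ι} {a B κ : ℝ} (ha : 0 < a) (hB : 0 < B)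
    (hκ : 0 < κ) {w : (ι → Bool) → ℝ}
    (hw : ∀ γ, w γ = κ * (∏ i, if γ i = true then a else 1) *
      if ∃ i ∈ S, γ i = true then B else 1) :
    IsCollinearPMF S a B fun γ => w γ / ∑ γ', w γ' := by
  have hpos : ∀ γ, 0 < w γ := fun γ => by
    rw [hw]
    refine mul_pos (mul_pos hκ (Finset.prod_pos fun i _ => ?_)) ?_ <;> split_ifs <;> simp [*]
  have hsum : 0 < ∑ γ', w γ' := Finset.sum_pos (fun γ _ => hpos γ) Finset.univ_nonempty
  refine ⟨ha, hB, fun γ => div_pos (hpos γ) hsum, ?_, fun j hj γ => ?_, fun i hi j hij γ hγ => ?_,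
    fun j hj γ hγ => ?_⟩
  · rw [← Finset.sum_div, div_self hsum.ne']
  · have hiff : ∀ b, (∃ i ∈ S, Function.update γ j b i = true) ↔ ∃ i ∈ S, γ i = true := fun b =>
      exists_congr fun i => and_congr_right fun hi => by
        rw [Function.update_of_ne fun h : i = j => hj (h ▸ hi)]
    rw [← mul_div_assoc]
    congr 1
    rw [hw, hw, prod_update_true]
    simp only [hiff]
    ring
  · have hact : ∀ b, ∃ i ∈ S, Function.update γ j b i = true := fun b =>
      ⟨i, hi, by rw [Function.update_of_ne hij, hγ]⟩
    rw [← mul_div_assoc]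
    congr 1
    rw [hw, hw, prod_update_true, if_pos (hact true), if_pos (hact false)]
    ring
  · have h1 : ∃ i ∈ S, Function.update γ j true i = true := ⟨j, hj, by simp⟩
    have h2 : ¬ ∃ i ∈ S, Function.update γ j false i = true := by
      rintro ⟨i, hi, h⟩
      by_cases hij : i = j
      · subst hij; simp at h
      · rw [Function.update_of_ne hij, hγ i hi hij] at h
        exact Bool.noConfusion h
    rw [← mul_div_assoc]
    congr 1
    rw [hw, hw, prod_update_true, if_pos h1, if_neg h2]
    ring

end Posterior

/-- Under a collinear design all models that contain one of the first `m` regressors share the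
residual `Yᵀ Y / (1 + c)`, and all others have residual `Yᵀ Y`. -/
theorem CollinearDesign.isCollinearPMF {n p m : ℕ} {X : Matrix (Fin n) (Fin p) ℝ} {Y : Fin n → ℝ}
    (hD : CollinearDesign m X Y) (hm : 0 < m) (hmp : m ≤ p) {c h : ℝ} (hc : 0 < c)
    (hh : h ∈ Set.Ioo (0 : ℝ) 1) :
    IsCollinearPMF (Finset.univ.filter fun i : Fin p => i.val < m)
      (h * (1 + c) ^ (-(1 / 2) : ℝ) / (1 - h)) ((1 + c) ^ ((n : ℝ) / 2))
      (posterior X Y c h) := by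
  have hYY : 0 < dotProduct Y Y := by
    have h0 : 0 ≤ dotProduct Y Y := by
      simpa using dotProduct_star_self_nonneg Y
    refine lt_of_le_of_ne h0 fun h => hD.data_ne_zero ?_
    exact dotProduct_self_eq_zero.1 h.symm
  have hc1 : 0 < 1 + c := by linarith
  have hh1 : 0 < 1 - h := by linarith [hh.2]
  have hh0 := hh.1
  refine isCollinearPMF_of_weight
    (κ := (1 - h) ^ Fintype.card (Fin p) * dotProduct Y Y ^ (-((n : ℝ) / 2)))
    (by positivity) (by positivity) (by positivity) fun γ => ?_
  rw [margLik, ← mul_assoc, prior_mul_rpow_numActive hc hh.2, Fintype.card_fin n]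
  have hres : residual X Y c γ ^ (-((n : ℝ) / 2)) = dotProduct Y Y ^ (-((n : ℝ) / 2)) *
      if ∃ i ∈ Finset.univ.filter fun i : Fin p => i.val < m, γ i = true
        then (1 + c) ^ ((n : ℝ) / 2) else 1 := by
    split_ifs with hact
    · obtain ⟨i, hi, hγ⟩ := hact
      obtain ⟨α, hα, hX⟩ := hD.collinear i (by simpa using hi)
      rw [residual_of_collinear hc hγ hα hX, Real.div_rpow hYY.le hc1.le, Real.rpow_neg hc1.le,
        div_inv_eq_mul]
    · rw [mul_one, residual_of_orthogonal]
      intro j hj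
      have hjm : m ≤ j.val := by
        by_contra! hlt
        exact hact ⟨j, by simpa using hlt, hj⟩
      -- the first regressor spans the line through `Y`
      obtain ⟨α, hα, hX⟩ := hD.collinear ⟨0, hm.trans_le hmp⟩ hm
      have h0 := hD.orthogonal ⟨0, hm.trans_le hmp⟩ j hm hjm
      rw [hX, smul_dotProduct, smul_eq_mul, mul_eq_zero] at h0
      rw [dotProduct_comm]
      exact h0.resolve_left hα
  rw [hres, ← mul_assoc]
  congr 1
  · ring
  · congr

/-! ### Asymptotics -/

/-- In the asymptotic regime the odds `a = h (1 + c)^{-1/2} / (1 - h)` tend to zero while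
`a² (1 + c)^{n/2}` and `1 - h` stay bounded away from zero. -/
theorem eventually_regime {n : ℕ → ℕ} {c h : ℕ → ℝ} (hc : ∀ p, 0 < c p)
    (hh : ∀ p, h p ∈ Set.Ioo (0 : ℝ) 1)
    (hA1 : Tendsto (fun p => h p * (1 + c p) ^ (-(1 / 2) : ℝ)) atTop (𝓝 0))
    (hA2 : limsup h atTop < 1)
    (hA3 : 0 < liminf
      (fun p => ((h p ^ 2 * (1 + c p) ^ (((n p : ℝ) - 2) / 2) : ℝ) : EReal)) atTop) :
    ∃ K δ : ℝ, 1 ≤ K ∧ 0 < δ ∧ ∀ᶠ p : ℕ in atTop, δ ≤ 1 - h p ∧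
      K * (h p * (1 + c p) ^ (-(1 / 2) : ℝ) / (1 - h p)) ≤ 1 ∧
      1 ≤ K * ((h p * (1 + c p) ^ (-(1 / 2) : ℝ) / (1 - h p)) ^ 2 *
        (1 + c p) ^ ((n p : ℝ) / 2)) := by
  obtain ⟨u, hu1, hu2⟩ := exists_between hA2
  obtain ⟨ε, hε0, hε⟩ := EReal.lt_iff_exists_real_btwn.1 hA3
  have hε0 : 0 < ε := by exact_mod_cast hε0
  have hbdd : IsBoundedUnder (· ≤ ·) atTop h := isBoundedUnder_of ⟨1, fun p => (hh p).2.le⟩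
  have hδ : 0 < 1 - u := by linarith
  have hK1 : 1 ≤ max 1 ε⁻¹ := le_max_left _ _
  have hK0 : 0 < max 1 ε⁻¹ := by linarith
  refine ⟨max 1 ε⁻¹, 1 - u, hK1, hδ, ?_⟩
  have hsmall : 0 < (1 - u) / max 1 ε⁻¹ := by positivity
  filter_upwards [eventually_lt_of_limsup_lt hu1 hbdd, eventually_lt_of_lt_liminf hε,
    hA1.eventually_lt_const hsmall] with p h1 h2 h3
  have h2 : ε < h p ^ 2 * (1 + c p) ^ (((n p : ℝ) - 2) / 2) := by exact_mod_cast h2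
  have hc1 : 0 < 1 + c p := by linarith [hc p]
  have hp0 := (hh p).1
  have hp1 : 0 < 1 - h p := by linarith [(hh p).2]
  refine ⟨by linarith, ?_, ?_⟩
  · rw [lt_div_iff₀ hK0] at h3
    rw [← mul_div_assoc, div_le_one hp1]
    linarith
  · have hpow : ((1 + c p) ^ (-(1 / 2) : ℝ)) ^ 2 * (1 + c p) ^ ((n p : ℝ) / 2) =
        (1 + c p) ^ (((n p : ℝ) - 2) / 2) := by
      rw [← Real.rpow_natCast, ← Real.rpow_mul hc1.le, ← Real.rpow_add hc1]
      congr 1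
      push_cast
      ring
    have hle : ε ≤ (h p * (1 + c p) ^ (-(1 / 2) : ℝ) / (1 - h p)) ^ 2 *
        (1 + c p) ^ ((n p : ℝ) / 2) := by
      rw [div_pow, mul_pow, div_mul_eq_mul_div, mul_assoc, hpow, le_div_iff₀ (by positivity)]
      have : (1 - h p) ^ 2 ≤ 1 := pow_le_one₀ hp1.le (by linarith)
      nlinarith
    calc (1 : ℝ) = ε⁻¹ * ε := (inv_mul_cancel₀ hε0.ne').symm
      _ ≤ _ := mul_le_mul (le_max_right _ _) hle hε0.le hK0.le

end BVS

theorem theorem3 (m : ℕ) (hm : 2 ≤ m) (k : ℝ) (hk : 0 ≤ k)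
    (n : ℕ → ℕ) (c h : ℕ → ℝ)
    (X : ∀ p : ℕ, Matrix (Fin (n p)) (Fin p) ℝ) (Y : ∀ p : ℕ, Fin (n p) → ℝ)
    (hc : ∀ p, 0 < c p) (hh : ∀ p, h p ∈ Set.Ioo (0 : ℝ) 1)
    (hdesign : ∀ p, m ≤ p → BVS.CollinearDesign m (X p) (Y p))
    (hA1 : Tendsto (fun p => h p * (1 + c p) ^ (-(1 / 2) : ℝ)) atTop (𝓝 0))
    (hA2 : limsup h atTop < 1)
    (hA3 : 0 < liminf
      (fun p => ((h p ^ 2 * (1 + c p) ^ (((n p : ℝ) - 2) / 2) : ℝ) : EReal)) atTop) :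
    (∃ C : ℝ, 0 < C ∧ ∀ᶠ p : ℕ in atTop,
      C * (c p ^ (1 / 2 : ℝ) * (h p)⁻¹ * p) ≤
        BVS.relaxGS (BVS.posterior (X p) (Y p) (c p) (h p))) ∧
    (∃ C : ℝ, 0 < C ∧ ∀ᶠ p : ℕ in atTop,
      C * (c p ^ (1 / 2 : ℝ) * (h p)⁻¹ * p) ≤
        BVS.relaxMetropolisedGS (BVS.posterior (X p) (Y p) (c p) (h p))) ∧
    (∃ C : ℝ, 0 < C ∧ ∀ᶠ p : ℕ in atTop,
      C * p ≤ BVS.relaxTGS (BVS.posterior (X p) (Y p) (c p) (h p))) ∧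
    (∃ C : ℝ, 0 < C ∧ ∀ᶠ p : ℕ in atTop,
      BVS.relaxWTGS (BVS.posterior (X p) (Y p) (c p) (h p)) k ≤
        C * BVS.expectedSize (BVS.posterior (X p) (Y p) (c p) (h p))) := by
  obtain ⟨K, δ, hK, hδ, hreg⟩ := BVS.eventually_regime hc hh hA1 hA2 hA3
  have hK0 : 0 < K := by linarith
  have hm0 : (0 : ℝ) < m := by exact_mod_cast (by omega : 0 < m)
  have hcard : ∀ p, m ≤ p → (Finset.univ.filter fun i : Fin p => i.val < m).card = m := by
    intro p hp
    rw [Fin.card_filter_val_lt, min_eq_right hp]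
  -- the lower bound for the two Gibbs samplers, with `1 / a = (1 - h) (1 + c)^{1/2} / h`
  have hgibbs : ∀ p, 0 < p → δ ≤ 1 - h p → δ / (2 * m * K) * (c p ^ (1 / 2 : ℝ) * (h p)⁻¹ * p) ≤
      (2 * m * (1 / (p : ℝ) * (K * (h p * (1 + c p) ^ (-(1 / 2) : ℝ) / (1 - h p)))))⁻¹ := by
    intro p hp hδp
    have hp0 : (0 : ℝ) < p := by exact_mod_cast hp
    have hc1 : 0 < 1 + c p := by linarith [hc p]
    have hpos := (hh p).1
    have hp1 : 0 < 1 - h p := by linarith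
    have hr : c p ^ (1 / 2 : ℝ) ≤ (1 + c p) ^ (1 / 2 : ℝ) :=
      Real.rpow_le_rpow (hc p).le (by linarith) (by norm_num)
    have hr0 : 0 < (1 + c p) ^ (1 / 2 : ℝ) := by positivity
    have heq : (2 * m * (1 / (p : ℝ) * (K * (h p * (1 + c p) ^ (-(1 / 2) : ℝ) / (1 - h p)))))⁻¹ =
        (1 - h p) / (2 * m * K) * ((1 + c p) ^ (1 / 2 : ℝ) * (h p)⁻¹ * p) := by
      rw [Real.rpow_neg hc1.le]
      field_simp
    rw [heq]
    have := Real.rpow_nonneg (hc p).le (1 / 2)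
    gcongr
  -- everything needed about the posterior for large `p`
  have hmain : ∀ᶠ p : ℕ in atTop, m ≤ p ∧ 0 < p ∧ δ ≤ 1 - h p ∧ ∃ a B : ℝ,
      a = h p * (1 + c p) ^ (-(1 / 2) : ℝ) / (1 - h p) ∧ K * a ≤ 1 ∧ 1 ≤ K * (a ^ 2 * B) ∧
      BVS.IsCollinearPMF (Finset.univ.filter fun i : Fin p => i.val < m) a B
        (BVS.posterior (X p) (Y p) (c p) (h p)) := by
    filter_upwards [hreg, eventually_ge_atTop m] with p hp hmp
    exact ⟨hmp, by omega, hp.1, _, _, rfl, hp.2.1, hp.2.2,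
      (hdesign p hmp).isCollinearPMF (by omega) hmp (hc p) (hh p)⟩
  have hmem : ∀ p (hmp : m ≤ p) (i : ℕ) (hi : i < m), (⟨i, hi.trans_le hmp⟩ : Fin p) ∈
      Finset.univ.filter fun i : Fin p => i.val < m := fun p hmp i hi => by simpa using hi
  refine ⟨⟨δ / (2 * m * K), by positivity, ?_⟩, ⟨δ / (2 * m * K), by positivity, ?_⟩,
    ⟨1 / (2 * m), by positivity, ?_⟩, ⟨2 * 4 ^ m * (1 + 2 * k), by positivity, ?_⟩⟩
  · filter_upwards [hmain] with p hreg
    obtain ⟨hmp, hp, hδp, a, B, rfl, -, hKB, H⟩ := hreg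
    have : Nonempty (Fin p) := ⟨⟨0, hp⟩⟩
    have := H.le_relaxGS hK hKB (hmem p hmp 0 (by omega)) (hmem p hmp 1 (by omega)) (by simp)
    rw [hcard p hmp, Fintype.card_fin] at this
    exact (hgibbs p hp hδp).trans this
  · filter_upwards [hmain] with p hreg
    obtain ⟨hmp, hp, hδp, a, B, rfl, -, hKB, H⟩ := hreg
    have : Nonempty (Fin p) := ⟨⟨0, hp⟩⟩
    have := H.le_relaxMetropolisedGS hK hKB (hmem p hmp 0 (by omega)) (hmem p hmp 1 (by omega))
      (by simp)
    rw [hcard p hmp, Fintype.card_fin] at this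
    exact (hgibbs p hp hδp).trans this
  · filter_upwards [hmain] with p hreg
    obtain ⟨hmp, hp, hδp, a, B, -, hKa, hKB, H⟩ := hreg
    have : Nonempty (Fin p) := ⟨⟨0, hp⟩⟩
    have h1 := H.le_relaxTGS hK hKB (hmem p hmp 0 (by omega)) (hmem p hmp 1 (by omega))
      (by simp)
    rw [hcard p hmp, Fintype.card_fin] at h1
    refine le_trans ?_ h1
    have hp0 : (0 : ℝ) < p := by exact_mod_cast hp
    have ha := H.odds_pos
    have h2 : 1 / (2 * (m : ℝ)) * p = (2 * m * ((p : ℝ)⁻¹ * 1))⁻¹ := by field_simp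
    rw [h2]
    gcongr
    linarith
  · filter_upwards [hmain] with p hreg
    obtain ⟨hmp, hp, hδp, a, B, -, hKa, hKB, H⟩ := hreg
    have : Nonempty (Fin p) := ⟨⟨0, hp⟩⟩
    have ha := H.odds_pos
    have hB := H.boost_pos
    have haB : 1 ≤ a * B := by
      have h1 : K * (a ^ 2 * B) = K * a * (a * B) := by ring
      have h2 : K * a * (a * B) ≤ 1 * (a * B) :=
        mul_le_mul_of_nonneg_right hKa (mul_pos ha hB).le
      linarith
    have := H.relaxWTGS_le (by nlinarith) haB (hmem p hmp 0 (by omega)) (hmem p hmp 1 (by omega))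
      (by simp) hk
    rwa [hcard p hmp] at this
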